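/- **Theorem (Maschke's Theorem for Doi-Hopf modules).** Let $k$ be a commutative ring, $H$ a $k$-bialgebra, and $(H,A,C)$ a Doi-Hopf datum: $A$ is a left $H$-comodule algebra with coaction $\rho_A(a)=\sum a_{<-1>}\otimes a_{<0>}$ (an algebra map $A\to H\otimes A$), and $C$ is a right $H$-module coalgebra that is flat as a $k$-module. Let ${}^C\mathcal M(H)_A$ be the category of Doi-Hopf modules, i.e. right $A$-modules $M$ that are also left $C$-comodules with $\rho_M(ma)=\sum m_{<-1>}\cdot a_{<-1>}\otimes m_{<0>}a_{<0>}$, with $A$-linear $C$-colinear maps as morphisms, and let $F:{}^C\mathcal M(H)_A\to\mathcal M_A$ be the functor forgetting the $C$-coaction. $F$ is called separable if the natural map $\mathrm{Hom}(M,N)\to\mathrm{Hom}_A(FM,FN)$ has a left inverse that is natural in $M$ and $N$. Write $(c\otimes b)a=\sum c\cdot a_{<-1>}\otimes ba_{<0>}$, $a(c\otimes b)=c\otimes ab$, $\rho(c\otimes b)=\sum c_{(1)}\otimes c_{(2)}\otimes b$ on $C\otimes A$; $(c\otimes d)(h\otimes a)=c\cdot h\otimes da$ for the action of $H\otimes A$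 on $C\otimes A$ ($d\in A$); on $C\otimes C\otimes A$ the Doi-Hopf structure $(c\otimes d\otimes b)a=\sum c\cdot a_{<-2>}\otimes d\cdot a_{<-1>}\otimes ba_{<0>}$, $\rho(c\otimes d\otimes b)=\sum c_{(1)}\otimes c_{(2)}\otimes d\otimes b$; and $(a\cdot f)(c)=\sum a_{<0>}f(c\cdot a_{<-1>})$, $(f\cdot a)(c)=f(c)a$ on $\mathrm{Hom}(C,A)$. A *total $A$-integral* is a $k$-linear map $\gamma:C\to\mathrm{Hom}(C,A)$ such that for all $a\in A$, $c,d\in C$ $$\sum a_{<0>}\cdot\gamma(c\cdot a_{<-1>})=\gamma(c)\cdot a,\qquad \sum c_{(1)}\otimes\gamma(c_{(2)})(d)=\sum d_{(2)}\cdot\gamma(c)(d_{(1)})_{<-1>}\otimes\gamma(c)(d_{(1)})_{<0>},\qquad \sum\gamma(c_{(1)})(c_{(2)})=\varepsilon(c)1_A .$$ (a) The following are equivalent (for all $a,b\in A$, $c,d\in C$ in each condition): - ($V_4$) there is a total $A$-integral $\gamma$; - ($V_1$) there is a morphism $\nu:C\otimes C\otimes A\to C\otimes A$ of Doi-Hopf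 modules with $\nu(c\otimes d\otimes ba)=b\,\nu(c\otimes d\otimes a)$, $\sum(d_{(2)}\otimes1)(\varepsilon_C\otimes\rho_A)\nu(c\otimes d_{(1)}\otimes1)=\nu(c\otimes d\otimes1)$ and $\sum\nu(c_{(1)}\otimes c_{(2)}\otimes a)=c\otimes a$; - ($V_2$) there is a $k$-linear map $\lambda:C\otimes C\to C\otimes A$ with $\sum(d_{(2)}\otimes1)(\varepsilon_C\otimes\rho_A)\lambda(c\otimes d_{(1)})=\lambda(c\otimes d)$, $\sum a_{<0>}\lambda(c\cdot a_{<-2>}\otimes d\cdot a_{<-1>})=\lambda(c\otimes d)a$, $\sum c_{(1)}\otimes\lambda(c_{(2)}\otimes d)=\rho(\lambda(c\otimes d))$ and $\sum\lambda(c_{(1)}\otimes c_{(2)})=c\otimes1$; - ($V_3$) there is a $k$-linear map $\theta:C\otimes C\to A$ with $\theta(c\otimes d)a=\sum a_{<0>}\theta(c\cdot a_{<-2>}\otimes d\cdot a_{<-1>})$, $\sum c_{(1)}\otimes\theta(c_{(2)}\otimes d)=\sum d_{(2)}\cdot\theta(c\otimes d_{(1)})_{<-1>}\otimes\theta(c\otimes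 d_{(1)})_{<0>}$ and $\sum\theta(c_{(1)}\otimes c_{(2)})=\varepsilon(c)1_A$; - ($V_5$) there is an $A$-bimodule map ($k$-linear) $\psi:C\otimes A\to\mathrm{Hom}(C,A)$ with $\sum c_{(1)}\otimes\psi(c_{(2)}\otimes1)(d)=\sum d_{(2)}\cdot\psi(c\otimes1)(d_{(1)})_{<-1>}\otimes\psi(c\otimes1)(d_{(1)})_{<0>}$ and $\sum\psi(c_{(1)}\otimes1)(c_{(2)})=\varepsilon(c)1_A$. (b) If these hold, then $F$ is separable. (c) Conversely, if $H$ is a Hopf algebra and $F$ is separable, then they hold. (d) If $F$ is separable (in particular if a total $A$-integral exists), then: 1) if a morphism $u$ of ${}^C\mathcal M(H)_A$ has a retraction (resp. a section) in $\mathcal M_A$, then it has a retraction (resp. a section) in ${}^C\mathcal M(H)_A$; 2) if $M\in{}^C\mathcal M(H)_A$ is semisimple (resp. projective, injective) as a right $A$-module, then $M$ is semisimple, i.e. a direct sum of simple objects (resp. projective, injective), as an object of ${}^C\mathcal M(H)_A$. -/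

import Mathlib

open CategoryTheory CategoryTheory.Limits
open scoped TensorProduct

universe u

namespace DoiHopf

/-! ## General categorical notions -/

/-- A functor `F : 𝒞 ⥤ 𝒟` is separable if the natural transformation
`Hom_𝒞(-,-) ⟶ Hom_𝒟(F -, F -)` of functors `𝒞ᵒᵖ × 𝒞 ⥤ Sets` has a left inverse that is natural
in both variables. -/
def IsSeparable {𝒞 𝒟 : Type*} [Category 𝒞] [Category 𝒟] (F : 𝒞 ⥤ 𝒟) : Prop :=
  ∃ P : ∀ M N : 𝒞, (F.obj M ⟶ F.obj N) → (M ⟶ N),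
    (∀ (M' M N N' : 𝒞) (a : M' ⟶ M) (g : F.obj M ⟶ F.obj N) (b : N ⟶ N'),
      P M' N' (F.map a ≫ g ≫ F.map b) = a ≫ P M N g ≫ b) ∧
    ∀ (M N : 𝒞) (f : M ⟶ N), P M N (F.map f) = f

/-- An object is semisimple if it is a coproduct (direct sum) of simple objects. -/
def IsSemisimpleObject {𝒞 : Type*} [Category.{u} 𝒞] [HasZeroMorphisms 𝒞] (M : 𝒞) : Prop :=
  ∃ (ι : Type u) (S : ι → 𝒞) (i : ∀ j, S j ⟶ M),
    (∀ j, Simple (S j)) ∧ Nonempty (IsColimit (Cofan.mk M i))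

/-- A bialgebra is a Hopf algebra if it has an antipode, i.e. if its bialgebra structure
underlies a Hopf algebra structure. -/
def IsHopf (k H : Type*) [CommRing k] [Ring H] [b : Bialgebra k H] : Prop :=
  ∃ h : HopfAlgebra k H, h.toBialgebra = b

/-! ## Comodules and actions -/

section Basic

variable (k : Type*) [CommRing k]

/-- `ρ : M → C ⊗ M` is a coassociative and counital left `C`-coaction. -/
structure IsLeftCoaction {C M : Type*} [AddCommGroup C] [Module k C] [Coalgebra k C]
    [AddCommGroup M] [Module k M] (ρ : M →ₗ[k] C ⊗[k] M) : Prop where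
  coassoc : ∀ m, TensorProduct.assoc k C C M ((Coalgebra.comul (R := k)).rTensor M (ρ m)) =
    ρ.lTensor C (ρ m)
  counit : ∀ m, TensorProduct.lid k M ((Coalgebra.counit (R := k)).rTensor M (ρ m)) = m

/-- The right action of a `k`-algebra `A` on a right `A`-module `M` (a left module over the
opposite algebra) as a bilinear map `m, a ↦ m a`. -/
def rightMul (A M : Type*) [Ring A] [Algebra k A] [AddCommGroup M] [Module k M]
    [Module Aᵐᵒᵖ M] [IsScalarTower k Aᵐᵒᵖ M] : M →ₗ[k] A →ₗ[k] M :=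
  ((Algebra.lsmul k k M).toLinearMap ∘ₗ (MulOpposite.opLinearEquiv k).toLinearMap).flip

@[simp] theorem rightMul_apply (A M : Type*) [Ring A] [Algebra k A] [AddCommGroup M] [Module k M]
    [Module Aᵐᵒᵖ M] [IsScalarTower k Aᵐᵒᵖ M] (m : M) (a : A) :
    rightMul k A M m a = MulOpposite.op a • m := rfl

end Basic

/-! ## Doi-Hopf data -/

section Data

variable (k H A C : Type u) [CommRing k] [Ring H] [Bialgebra k H] [Ring A] [Algebra k A]
  [AddCommGroup C] [Module k C] [Coalgebra k C]

/-- A Doi-Hopf datum `(H, A, C)`: the `k`-algebra `A` is a left `H`-comodule algebra, and the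
`k`-coalgebra `C`, flat over `k`, is a right `H`-module coalgebra. -/
structure Datum where
  /-- the coaction `a ↦ ∑ a₍₋₁₎ ⊗ a₍₀₎`, an algebra map -/
  coact : A →ₐ[k] H ⊗[k] A
  isLeftCoaction : IsLeftCoaction k coact.toLinearMap
  /-- the right action `c, h ↦ c · h` -/
  act : C →ₗ[k] H →ₗ[k] C
  act_one : ∀ c, act c 1 = c
  act_mul : ∀ c h h', act c (h * h') = act (act c h) h'
  comul_act : ∀ c h, Coalgebra.comul (R := k) (act c h) =
    TensorProduct.map₂ act act (Coalgebra.comul (R := k) c) (Coalgebra.comul (R := k) h)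
  counit_act : ∀ c h, Coalgebra.counit (R := k) (act c h) =
    Coalgebra.counit (R := k) c * Coalgebra.counit (R := k) h
  flat : Module.Flat k C

end Data

section Modules

variable {k H A C : Type u} [CommRing k] [Ring H] [Bialgebra k H] [Ring A] [Algebra k A]
  [AddCommGroup C] [Module k C] [Coalgebra k C] (D : Datum k H A C)

/-- The action `(c ⊗ m)(h ⊗ a) = c · h ⊗ m a` of `H ⊗ A` on `C ⊗ M`, for a right `A`-module `M`. -/
noncomputable def Datum.pairAct (M : Type*) [AddCommGroup M] [Module k M] [Module Aᵐᵒᵖ M]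
    [IsScalarTower k Aᵐᵒᵖ M] : C ⊗[k] M →ₗ[k] H ⊗[k] A →ₗ[k] C ⊗[k] M :=
  TensorProduct.map₂ D.act (rightMul k A M)

@[simp] theorem Datum.pairAct_tmul (M : Type*) [AddCommGroup M] [Module k M] [Module Aᵐᵒᵖ M]
    [IsScalarTower k Aᵐᵒᵖ M] (c : C) (m : M) (h : H) (a : A) :
    D.pairAct M (c ⊗ₜ m) (h ⊗ₜ a) = D.act c h ⊗ₜ (MulOpposite.op a • m) := rfl

theorem Datum.pairAct_one (M : Type*) [AddCommGroup M] [Module k M] [Module Aᵐᵒᵖ M]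
    [IsScalarTower k Aᵐᵒᵖ M] (x : C ⊗[k] M) : D.pairAct M x 1 = x := by
  rw [Algebra.TensorProduct.one_def]
  induction x with
  | zero => simp
  | tmul c m => simp [D.act_one]
  | add x y hx hy => rw [map_add, LinearMap.add_apply, hx, hy]

theorem Datum.pairAct_mul (M : Type*) [AddCommGroup M] [Module k M] [Module Aᵐᵒᵖ M]
    [IsScalarTower k Aᵐᵒᵖ M] (x : C ⊗[k] M) (y z : H ⊗[k] A) :
    D.pairAct M x (y * z) = D.pairAct M (D.pairAct M x y) z := by
  induction x with
  | zero => simp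
  | add x x' hx hx' => simp only [map_add, LinearMap.add_apply, hx, hx']
  | tmul c m =>
    induction y with
    | zero => simp
    | add y y' hy hy' => simp only [add_mul, map_add, LinearMap.add_apply, hy, hy']
    | tmul h a =>
      induction z with
      | zero => simp
      | add z z' hz hz' => simp only [mul_add, map_add, hz, hz']
      | tmul h' a' => simp [D.act_mul, mul_smul]

/-- A right-left Doi-Hopf module: a `k`-module with a right `A`-action and a left `C`-coaction
`ρ` such that `ρ(m a) = ∑ m₍₋₁₎ · a₍₋₁₎ ⊗ m₍₀₎ a₍₀₎`. -/
structure DHModule where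
  carrier : Type u
  [addCommGroup : AddCommGroup carrier]
  [module : Module k carrier]
  [rightModule : Module Aᵐᵒᵖ carrier]
  [isScalarTower : IsScalarTower k Aᵐᵒᵖ carrier]
  coact : carrier →ₗ[k] C ⊗[k] carrier
  isLeftCoaction : IsLeftCoaction k coact
  coact_smul : ∀ (m : carrier) (a : A),
    coact (MulOpposite.op a • m) = D.pairAct carrier (coact m) (D.coact a)

attribute [instance] DHModule.addCommGroup DHModule.module DHModule.rightModule
  DHModule.isScalarTower

/-- Morphisms of Doi-Hopf modules: right `A`-linear, left `C`-colinear maps. -/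
@[ext]
structure DHModule.Hom {D : Datum k H A C} (M N : DHModule D) where
  toLinearMap : M.carrier →ₗ[Aᵐᵒᵖ] N.carrier
  colinear : ∀ m, N.coact (toLinearMap m) =
    (toLinearMap.restrictScalars k).lTensor C (M.coact m)

/-- The category of right-left Doi-Hopf modules. -/
instance (D : Datum k H A C) : Category.{u} (DHModule D) where
  Hom := DHModule.Hom
  id M := ⟨LinearMap.id, fun m => (LinearMap.lTensor_id_apply C M.carrier (M.coact m)).symm⟩
  comp {M N P} f g := ⟨g.toLinearMap ∘ₗ f.toLinearMap, fun m => by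
    rw [LinearMap.comp_apply, g.colinear, f.colinear, ← LinearMap.lTensor_comp_apply]
    rfl⟩

noncomputable instance (D : Datum k H A C) : HasZeroMorphisms (DHModule D) where
  zero M N := ⟨⟨0, fun m => by
    have : ((0 : M.carrier →ₗ[Aᵐᵒᵖ] N.carrier).restrictScalars k) = 0 := rfl
    rw [this]; simp⟩⟩
  comp_zero {M N} f P := by
    apply DHModule.Hom.ext
    exact LinearMap.zero_comp _
  zero_comp M {N P} f := by
    apply DHModule.Hom.ext
    exact LinearMap.comp_zero _

/-- The functor from Doi-Hopf modules to right `A`-modules forgetting the `C`-coaction. -/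
def forgetCoaction (D : Datum k H A C) : DHModule D ⥤ ModuleCat.{u} Aᵐᵒᵖ where
  obj M := ModuleCat.of Aᵐᵒᵖ M.carrier
  map f := ModuleCat.ofHom (DHModule.Hom.toLinearMap f)

/-- The right `A`-module structure `(c ⊗ m) a = ∑ c · a₍₋₁₎ ⊗ m a₍₀₎` on `C ⊗ M`. -/
@[reducible] noncomputable def Datum.tensorModule (M : Type*) [AddCommGroup M] [Module k M]
    [Module Aᵐᵒᵖ M] [IsScalarTower k Aᵐᵒᵖ M] : Module Aᵐᵒᵖ (C ⊗[k] M) where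
  smul a x := D.pairAct M x (D.coact a.unop)
  one_smul x := by
    change D.pairAct M x (D.coact 1) = x
    rw [map_one, D.pairAct_one]
  mul_smul a b x := by
    change D.pairAct M x (D.coact (b.unop * a.unop)) =
      D.pairAct M (D.pairAct M x (D.coact b.unop)) (D.coact a.unop)
    rw [map_mul, D.pairAct_mul]
  smul_zero a := by
    change D.pairAct M 0 (D.coact a.unop) = 0
    simp
  smul_add a x y := by
    change D.pairAct M (x + y) (D.coact a.unop) =
      D.pairAct M x (D.coact a.unop) + D.pairAct M y (D.coact a.unop)
    simp
  add_smul a b x := by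
    change D.pairAct M x (D.coact (a.unop + b.unop)) =
      D.pairAct M x (D.coact a.unop) + D.pairAct M x (D.coact b.unop)
    simp
  zero_smul x := by
    change D.pairAct M x (D.coact 0) = 0
    simp

/-- The coaction `c ⊗ m ↦ ∑ c₍₁₎ ⊗ (c₍₂₎ ⊗ m)` on `C ⊗ M`. -/
noncomputable def tensorCoact (k C M : Type*) [CommRing k] [AddCommGroup C] [Module k C]
    [Coalgebra k C] [AddCommGroup M] [Module k M] : C ⊗[k] M →ₗ[k] C ⊗[k] (C ⊗[k] M) :=
  (TensorProduct.assoc k C C M).toLinearMap ∘ₗ (Coalgebra.comul (R := k)).rTensor M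

@[simp] theorem tensorCoact_tmul (k C M : Type*) [CommRing k] [AddCommGroup C] [Module k C]
    [Coalgebra k C] [AddCommGroup M] [Module k M] (c : C) (m : M) :
    tensorCoact k C M (c ⊗ₜ m) =
      TensorProduct.assoc k C C M (Coalgebra.comul (R := k) c ⊗ₜ m) := rfl

theorem tensorCoact_isLeftCoaction (k C M : Type*) [CommRing k] [AddCommGroup C] [Module k C]
    [Coalgebra k C] [AddCommGroup M] [Module k M] : IsLeftCoaction k (tensorCoact k C M) where
  coassoc x := by
    induction x with
    | zero => simp
    | add x y hx hy => simp only [map_add, hx, hy]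
    | tmul c m =>
      have h1 : ∀ y : C ⊗[k] C, TensorProduct.assoc k C C (C ⊗[k] M)
          ((Coalgebra.comul (R := k)).rTensor (C ⊗[k] M) (TensorProduct.assoc k C C M (y ⊗ₜ m))) =
          (TensorProduct.assoc k C C M).toLinearMap.lTensor C (TensorProduct.assoc k C (C ⊗[k] C) M
            (TensorProduct.assoc k C C C ((Coalgebra.comul (R := k)).rTensor C y) ⊗ₜ m)) := by
        intro y
        induction y with
        | zero => simp
        | add x y hx hy => simp only [map_add, TensorProduct.add_tmul, hx, hy]
        | tmul a b =>
          simp only [TensorProduct.assoc_tmul, LinearMap.rTensor_tmul]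
          generalize Coalgebra.comul (R := k) a = z
          induction z with
          | zero => simp
          | add x y hx hy => simp only [map_add, TensorProduct.add_tmul, hx, hy]
          | tmul p q => simp
      have h2 : ∀ y : C ⊗[k] C, (tensorCoact k C M).lTensor C
          (TensorProduct.assoc k C C M (y ⊗ₜ m)) =
          (TensorProduct.assoc k C C M).toLinearMap.lTensor C (TensorProduct.assoc k C (C ⊗[k] C) M
            ((Coalgebra.comul (R := k)).lTensor C y ⊗ₜ m)) := by
        intro y
        induction y with
        | zero => simp
        | add x y hx hy => simp only [map_add, TensorProduct.add_tmul, hx, hy]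
        | tmul a b => simp
      rw [tensorCoact_tmul, h1, h2, Coalgebra.coassoc_apply]
  counit x := by
    induction x with
    | zero => simp
    | add x y hx hy => simp only [map_add, hx, hy]
    | tmul c m =>
      have h1 : ∀ y : C ⊗[k] C, TensorProduct.lid k (C ⊗[k] M)
          ((Coalgebra.counit (R := k)).rTensor (C ⊗[k] M)
            (TensorProduct.assoc k C C M (y ⊗ₜ m))) =
          TensorProduct.lid k C ((Coalgebra.counit (R := k)).rTensor C y) ⊗ₜ m := by
        intro y
        induction y with
        | zero => simp
        | add x y hx hy => simp only [map_add, TensorProduct.add_tmul, hx, hy]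
        | tmul a b => simp [TensorProduct.smul_tmul']
      rw [tensorCoact_tmul, h1, Coalgebra.rTensor_counit_comul]
      simp

theorem Datum.tensorCoact_pairAct (M : Type*) [AddCommGroup M] [Module k M]
    [Module Aᵐᵒᵖ M] [IsScalarTower k Aᵐᵒᵖ M] (c d : C) (m : M) (a : A) :
    TensorProduct.assoc k C C M
      (TensorProduct.map (TensorProduct.map₂ D.act D.act (c ⊗ₜ[k] d) ∘ₗ Coalgebra.comul (R := k))
        (rightMul k A M m) (D.coact a)) =
      TensorProduct.map (D.act c) (D.pairAct M (d ⊗ₜ[k] m) ∘ₗ D.coact.toLinearMap)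
        (D.coact a) := by
  have h1 : TensorProduct.map (D.act c) (D.pairAct M (d ⊗ₜ[k] m) ∘ₗ D.coact.toLinearMap)
        (D.coact a) = TensorProduct.map (D.act c) (D.pairAct M (d ⊗ₜ[k] m))
          (D.coact.toLinearMap.lTensor H (D.coact.toLinearMap a)) := by
    rw [← LinearMap.comp_apply, LinearMap.map_comp_lTensor]
    rfl
  rw [h1, ← D.isLeftCoaction.coassoc, AlgHom.toLinearMap_apply]
  generalize D.coact a = y
  induction y with
  | zero => simp
  | add x y hx hy => simp only [map_add, hx, hy]
  | tmul h b =>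
    simp only [TensorProduct.map_tmul, LinearMap.comp_apply, LinearMap.rTensor_tmul]
    generalize Coalgebra.comul (R := k) h = z
    induction z with
    | zero => simp
    | add x y hx hy => simp only [map_add, TensorProduct.add_tmul, hx, hy]
    | tmul p q => simp

/-- The Doi-Hopf module `C ⊗ M` induced by a right `A`-module `M`. -/
noncomputable def Datum.induced (M : Type u) [AddCommGroup M] [Module k M]
    [Module Aᵐᵒᵖ M] [IsScalarTower k Aᵐᵒᵖ M] : DHModule D :=
  letI := D.tensorModule M
  haveI : IsScalarTower k Aᵐᵒᵖ (C ⊗[k] M) := ⟨fun r a x => by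
    change D.pairAct M x (D.coact (r • a.unop)) = r • D.pairAct M x (D.coact a.unop)
    simp⟩
  { carrier := C ⊗[k] M
    coact := tensorCoact k C M
    isLeftCoaction := tensorCoact_isLeftCoaction k C M
    coact_smul := fun x a => by
      change tensorCoact k C M (D.pairAct M x (D.coact a)) =
        D.pairAct (C ⊗[k] M) (tensorCoact k C M x) (D.coact a)
      induction x with
      | zero => simp
      | add x y hx hy => simp only [map_add, LinearMap.add_apply, hx, hy]
      | tmul c m =>
        have h1 : tensorCoact k C M (D.pairAct M (c ⊗ₜ m) (D.coact a)) =
            TensorProduct.assoc k C C M (TensorProduct.map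
              (TensorProduct.map₂ D.act D.act (Coalgebra.comul (R := k) c) ∘ₗ
                Coalgebra.comul (R := k)) (rightMul k A M m) (D.coact a)) := by
          generalize D.coact a = y
          induction y with
          | zero => simp
          | add x y hx hy => simp only [map_add, hx, hy]
          | tmul h b => simp [D.comul_act]
        rw [h1, tensorCoact_tmul]
        generalize Coalgebra.comul (R := k) c = z
        induction z with
        | zero => simp
        | add x y hx hy =>
          simp only [map_add, LinearMap.add_comp, TensorProduct.map_add_left, LinearMap.add_apply,
            TensorProduct.add_tmul, hx, hy]
        | tmul p q =>
          rw [D.tensorCoact_pairAct]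
          rfl }

end Modules

/-! ## Integrals -/

section Integrals

variable {k H A C : Type u} [CommRing k] [Ring H] [Bialgebra k H] [Ring A] [Algebra k A]
  [AddCommGroup C] [Module k C] [Coalgebra k C] (D : Datum k H A C)

/-- The Doi-Hopf module `C ⊗ A`. -/
noncomputable def Datum.CA : DHModule D := D.induced A

/-- The Doi-Hopf module `C ⊗ C ⊗ A`, with `(c ⊗ d ⊗ b) a = ∑ c·a₍₋₂₎ ⊗ d·a₍₋₁₎ ⊗ b a₍₀₎`
and `ρ(c ⊗ d ⊗ b) = ∑ c₍₁₎ ⊗ c₍₂₎ ⊗ d ⊗ b`. -/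
noncomputable def Datum.CCA : DHModule D := D.induced D.CA.carrier

/-- The left `A`-action `a (c ⊗ b) = c ⊗ a b` on `C ⊗ A`. -/
noncomputable def Datum.leftCA (_ : Datum k H A C) : A →ₗ[k] C ⊗[k] A →ₗ[k] C ⊗[k] A :=
  LinearMap.lTensorHom C ∘ₗ LinearMap.mul k A

/-- The diagonal right `H`-action `(c ⊗ d) · h = ∑ c · h₍₁₎ ⊗ d · h₍₂₎` on `C ⊗ C`. -/
noncomputable def Datum.act₂ : C ⊗[k] C →ₗ[k] H →ₗ[k] C ⊗[k] C :=
  (TensorProduct.map₂ D.act D.act).compl₂ (Coalgebra.comul (R := k))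

/-- For `X` with a right `H`-action and `N` with a left `A`-action, the action of `a` on
`f : X → N` given by `x ↦ ∑ a₍₀₎ f(x · a₍₋₁₎)`. -/
noncomputable def Datum.twistedAct {X N : Type*} [AddCommGroup X] [Module k X] [AddCommGroup N]
    [Module k N] (actX : X →ₗ[k] H →ₗ[k] X) (actN : A →ₗ[k] N →ₗ[k] N) :
    A →ₗ[k] (X →ₗ[k] N) →ₗ[k] (X →ₗ[k] N) :=
  LinearMap.mk₂ k
    (fun a f =>
      { toFun := fun x => TensorProduct.lift (actN.flip ∘ₗ f ∘ₗ actX x) (D.coact a)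
        map_add' := fun x y => by
          generalize D.coact a = z
          induction z with
          | zero => simp
          | add z w hz hw => simp only [map_add] at hz hw ⊢; rw [hz, hw]; abel
          | tmul h b => simp
        map_smul' := fun r x => by
          generalize D.coact a = z
          induction z with
          | zero => simp
          | add z w hz hw => simp only [map_add, smul_add] at hz hw ⊢; rw [hz, hw]
          | tmul h b => simp })
    (fun a b f => by ext x; simp)
    (fun r a f => by ext x; simp)
    (fun a f g => by
      ext x
      simp only [LinearMap.coe_mk, AddHom.coe_mk, LinearMap.add_apply]
      generalize D.coact a = z
      induction z with
      | zero => simp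
      | add z w hz hw => simp only [map_add] at hz hw ⊢; rw [hz, hw]; abel
      | tmul h b => simp)
    (fun r a f => by
      ext x
      simp only [LinearMap.coe_mk, AddHom.coe_mk, LinearMap.smul_apply]
      generalize D.coact a = z
      induction z with
      | zero => simp
      | add z w hz hw => simp only [map_add, smul_add] at hz hw ⊢; rw [hz, hw]
      | tmul h b => simp)

/-- The left `A`-action `(a · f)(c) = ∑ a₍₀₎ f(c · a₍₋₁₎)` on `Hom(C, A)`. -/
noncomputable def Datum.homLeft : A →ₗ[k] (C →ₗ[k] A) →ₗ[k] (C →ₗ[k] A) :=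
  D.twistedAct D.act (LinearMap.mul k A)

/-- The right `A`-action `(f · a)(c) = f(c) a` on `Hom(C, A)`. -/
noncomputable def Datum.homRight (_ : Datum k H A C) (f : C →ₗ[k] A) (a : A) : C →ₗ[k] A :=
  LinearMap.mulRight k a ∘ₗ f

/-- The map `(h ⊗ a) ⊗ d ↦ (d ⊗ 1)(h ⊗ a) = d · h ⊗ a`. -/
noncomputable def Datum.swapAct : (H ⊗[k] A) ⊗[k] C →ₗ[k] C ⊗[k] A :=
  TensorProduct.lift ((D.pairAct A).flip.compl₂ ((TensorProduct.mk k C A).flip 1))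

/-- The map `ε_C ⊗ ρ_A : C ⊗ A → H ⊗ A`. -/
noncomputable def Datum.counitCoact : C ⊗[k] A →ₗ[k] H ⊗[k] A :=
  (TensorProduct.lid k (H ⊗[k] A)).toLinearMap ∘ₗ
    TensorProduct.map (Coalgebra.counit (R := k)) D.coact.toLinearMap

/-- For `f : C → A` and `d ∈ C`, the element `∑ d₍₂₎ · f(d₍₁₎)₍₋₁₎ ⊗ f(d₍₁₎)₍₀₎` of `C ⊗ A`. -/
noncomputable def Datum.spread (f : C →ₗ[k] A) (d : C) : C ⊗[k] A :=
  D.swapAct ((D.coact.toLinearMap ∘ₗ f).rTensor C (Coalgebra.comul (R := k) d))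

/-- For `g : C → C ⊗ A` and `d ∈ C`, the element `∑ (d₍₂₎ ⊗ 1)((ε_C ⊗ ρ_A) g(d₍₁₎))` of
`C ⊗ A`. -/
noncomputable def Datum.spreadCA (g : C →ₗ[k] C ⊗[k] A) (d : C) : C ⊗[k] A :=
  D.swapAct ((D.counitCoact ∘ₗ g).rTensor C (Coalgebra.comul (R := k) d))

/-- The `k`-linear map underlying a morphism `C ⊗ C ⊗ A ⟶ C ⊗ A` of Doi-Hopf modules. -/
noncomputable def Datum.underlying (ν : D.CCA ⟶ D.CA) : C ⊗[k] (C ⊗[k] A) →ₗ[k] C ⊗[k] A :=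
  (DHModule.Hom.toLinearMap ν).restrictScalars k

/-- The space `V₁`: morphisms of Doi-Hopf modules `ν : C ⊗ C ⊗ A → C ⊗ A` with
`ν(c ⊗ d ⊗ b a) = b ν(c ⊗ d ⊗ a)` and
`∑ (d₍₂₎ ⊗ 1)(ε_C ⊗ ρ_A) ν(c ⊗ d₍₁₎ ⊗ 1) = ν(c ⊗ d ⊗ 1)`. -/
structure IsV₁ (ν : D.CCA ⟶ D.CA) : Prop where
  left_linear : ∀ (a b : A) (c d : C),
    D.underlying ν (c ⊗ₜ (d ⊗ₜ (b * a))) = D.leftCA b (D.underlying ν (c ⊗ₜ (d ⊗ₜ a)))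
  spread : ∀ c d : C,
    D.spreadCA (D.underlying ν ∘ₗ TensorProduct.mk k C (C ⊗[k] A) c ∘ₗ
      (TensorProduct.mk k C A).flip 1) d = D.underlying ν (c ⊗ₜ (d ⊗ₜ 1))

/-- `∑ ν(c₍₁₎ ⊗ c₍₂₎ ⊗ a) = c ⊗ a`. -/
def IsNormalized₁ (ν : D.CCA ⟶ D.CA) : Prop :=
  ∀ (c : C) (a : A), D.underlying ν (tensorCoact k C A (c ⊗ₜ a)) = c ⊗ₜ a

/-- The space `V₂` of maps `λ : C ⊗ C → C ⊗ A` with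
`∑ (d₍₂₎ ⊗ 1)(ε_C ⊗ ρ_A) λ(c ⊗ d₍₁₎) = λ(c ⊗ d)`,
`∑ a₍₀₎ λ(c·a₍₋₂₎ ⊗ d·a₍₋₁₎) = λ(c ⊗ d) a` and
`∑ c₍₁₎ ⊗ λ(c₍₂₎ ⊗ d) = ρ_{C ⊗ A}(λ(c ⊗ d))`. -/
structure IsV₂ (l : C ⊗[k] C →ₗ[k] C ⊗[k] A) : Prop where
  spread : ∀ c d : C, D.spreadCA (l ∘ₗ TensorProduct.mk k C C c) d = l (c ⊗ₜ d)
  central : ∀ (a : A) (c d : C), D.twistedAct D.act₂ D.leftCA a l (c ⊗ₜ d) =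
    D.pairAct A (l (c ⊗ₜ d)) (D.coact a)
  colinear : ∀ c d : C, l.lTensor C (tensorCoact k C C (c ⊗ₜ d)) = tensorCoact k C A (l (c ⊗ₜ d))

/-- `∑ λ(c₍₁₎ ⊗ c₍₂₎) = c ⊗ 1`. -/
def IsNormalized₂ (_ : Datum k H A C) (l : C ⊗[k] C →ₗ[k] C ⊗[k] A) : Prop :=
  ∀ c : C, l (Coalgebra.comul (R := k) c) = c ⊗ₜ 1

/-- The space `V₃` of maps `θ : C ⊗ C → A` with
`θ(c ⊗ d) a = ∑ a₍₀₎ θ(c·a₍₋₂₎ ⊗ d·a₍₋₁₎)` and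
`∑ c₍₁₎ ⊗ θ(c₍₂₎ ⊗ d) = ∑ d₍₂₎ · θ(c ⊗ d₍₁₎)₍₋₁₎ ⊗ θ(c ⊗ d₍₁₎)₍₀₎`. -/
structure IsV₃ (θ : C ⊗[k] C →ₗ[k] A) : Prop where
  central : ∀ (c d : C) (a : A),
    θ (c ⊗ₜ d) * a = D.twistedAct D.act₂ (LinearMap.mul k A) a θ (c ⊗ₜ d)
  spread : ∀ c d : C, θ.lTensor C (tensorCoact k C C (c ⊗ₜ d)) =
    D.spread (θ ∘ₗ TensorProduct.mk k C C c) d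

/-- `∑ θ(c₍₁₎ ⊗ c₍₂₎) = ε(c) 1`. -/
def IsNormalized₃ (_ : Datum k H A C) (θ : C ⊗[k] C →ₗ[k] A) : Prop :=
  ∀ c : C, θ (Coalgebra.comul (R := k) c) = algebraMap k A (Coalgebra.counit (R := k) c)

/-- The space `V₄` of `A`-integrals: maps `γ : C → Hom(C, A)` with
`∑ a₍₀₎ · γ(c · a₍₋₁₎) = γ(c) · a` (the left `A`-action `a ⇀ γ` on `Hom(C, Hom(C, A))` agrees
with the right one) and
`∑ c₍₁₎ ⊗ γ(c₍₂₎)(d) = ∑ d₍₂₎ · γ(c)(d₍₁₎)₍₋₁₎ ⊗ γ(c)(d₍₁₎)₍₀₎`. -/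
structure IsIntegral (γ : C →ₗ[k] C →ₗ[k] A) : Prop where
  central : ∀ (a : A) (c : C), D.twistedAct D.act D.homLeft a γ c = D.homRight (γ c) a
  spread : ∀ c d : C, (γ.flip d).lTensor C (Coalgebra.comul (R := k) c) = D.spread (γ c) d

/-- A total `A`-integral: an `A`-integral `γ` with `∑ γ(c₍₁₎)(c₍₂₎) = ε(c) 1`. -/
structure IsTotalIntegral (γ : C →ₗ[k] C →ₗ[k] A) : Prop extends IsIntegral D γ where
  normalized : ∀ c : C, TensorProduct.lift γ (Coalgebra.comul (R := k) c) =
    algebraMap k A (Coalgebra.counit (R := k) c)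

/-- The space `V₅` of `A`-bimodule maps `ψ : C ⊗ A → Hom(C, A)` with
`∑ c₍₁₎ ⊗ ψ(c₍₂₎ ⊗ 1)(d) = ∑ d₍₂₎ · ψ(c ⊗ 1)(d₍₁₎)₍₋₁₎ ⊗ ψ(c ⊗ 1)(d₍₁₎)₍₀₎`. -/
structure IsV₅ (ψ : C ⊗[k] A →ₗ[k] C →ₗ[k] A) : Prop where
  left_linear : ∀ (a : A) (x : C ⊗[k] A), ψ (D.leftCA a x) = D.homLeft a (ψ x)
  right_linear : ∀ (a : A) (x : C ⊗[k] A),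
    ψ (D.pairAct A x (D.coact a)) = D.homRight (ψ x) a
  spread : ∀ c d : C,
    ((ψ ∘ₗ (TensorProduct.mk k C A).flip 1).flip d).lTensor C (Coalgebra.comul (R := k) c) =
      D.spread (ψ (c ⊗ₜ 1)) d

/-- `∑ ψ(c₍₁₎ ⊗ 1)(c₍₂₎) = ε(c) 1`. -/
def IsNormalized₅ (_ : Datum k H A C) (ψ : C ⊗[k] A →ₗ[k] C →ₗ[k] A) : Prop :=
  ∀ c : C, TensorProduct.lift (ψ ∘ₗ (TensorProduct.mk k C A).flip 1) (Coalgebra.comul (R := k) c) =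
    algebraMap k A (Coalgebra.counit (R := k) c)

end Integrals

end DoiHopf

/-! The forgetful functor `F` has the right adjoint `M ↦ C ⊗ M`, with unit the coaction `M ⟶ C ⊗ M`
and counit `ε ⊗ M`. As for any left adjoint, `F` is separable exactly when the unit has a retraction
`ν_M : C ⊗ M ⟶ M` natural in `M`. Everything rests on describing such retractions by a single map `θ
: C ⊗ C → A`, through `ν_M(c ⊗ m) = ∑ m₍₀₎ θ(c ⊗ m₍₋₁₎)`. Centrality of `θ` makes `ν_M` right
`A`-linear (`IsV₃.act₂Lift_pairAct`), the spread condition makes it colinear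
(`IsV₃.coact_averageLinear`), and normalization makes it split the coaction
(`IsV₃.coactHom_average`). Conversely, `exists_V₁_of_isSeparable` recovers `θ` from `ν` at `C ⊗ A`:
naturality along the coaction of `M` and along the maps `A → M`, `1 ↦ m`, forces the formula.

The five descriptions of an integral are linked by universal properties. `V₃` and `V₄` differ by
currying. `V₂` and `V₃` correspond because a colinear map into the cofree comodule `C ⊗ A` is
determined by its composite with `ε ⊗ A`. `V₁` and `V₅` are the left `A`-linear extensions of `V₂`
and `V₄`. Coassociativity of `ρ_A` matches diagonal actions with iterated ones.

The splitting and lifting statements follow by applying the natural left inverse to an `A`-linear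
map. Flatness of `C` makes kernels and finite intersections of Doi-Hopf submodules again Doi-Hopf
submodules; hence monomorphisms are injective. Doi-Hopf submodules form a modular lattice. If `M` is
semisimple over `A`, this lattice is compactly generated, and separability makes it complemented;
the top is then an independent join of atoms, which is a coproduct of simple objects. -/

namespace DoiHopf

/-! ### Twisted actions of `A` and coassociativity. -/

section Twisted

variable {k H A C : Type u} [CommRing k] [Ring H] [Bialgebra k H] [Ring A] [Algebra k A]
  [AddCommGroup C] [Module k C] [Coalgebra k C] (D : Datum k H A C)

/-- The diagonal right `H`-action `(c ⊗ x) · h = ∑ c · h₍₁₎ ⊗ x · h₍₂₎` on `C ⊗ X`. -/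
noncomputable def Datum.diagAct {X : Type*} [AddCommGroup X] [Module k X]
    (actX : X →ₗ[k] H →ₗ[k] X) : C ⊗[k] X →ₗ[k] H →ₗ[k] C ⊗[k] X :=
  (TensorProduct.map₂ D.act actX).compl₂ (Coalgebra.comul (R := k))

theorem Datum.diagAct_apply {X : Type*} [AddCommGroup X] [Module k X]
    (actX : X →ₗ[k] H →ₗ[k] X) (y : C ⊗[k] X) (h : H) :
    D.diagAct actX y h = TensorProduct.map₂ D.act actX y (Coalgebra.comul (R := k) h) := rfl

theorem Datum.act₂_eq_diagAct : D.act₂ = D.diagAct D.act := rfl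

theorem Datum.twistedAct_apply {X N : Type*} [AddCommGroup X] [Module k X] [AddCommGroup N]
    [Module k N] (actX : X →ₗ[k] H →ₗ[k] X) (actN : A →ₗ[k] N →ₗ[k] N) (a : A) (f : X →ₗ[k] N)
    (x : X) : D.twistedAct actX actN a f x =
      TensorProduct.lift (actN.flip ∘ₗ f ∘ₗ actX x) (D.coact a) := rfl

theorem Datum.coact_coassoc (a : A) :
    TensorProduct.assoc k H H A ((Coalgebra.comul (R := k)).rTensor A (D.coact a)) =
      D.coact.toLinearMap.lTensor H (D.coact a) :=
  D.isLeftCoaction.coassoc a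

theorem Datum.coact_counit (a : A) :
    TensorProduct.lid k A ((Coalgebra.counit (R := k)).rTensor A (D.coact a)) = a :=
  D.isLeftCoaction.counit a

/-- The twisted action for a diagonal action is an iterated twisted action. -/
theorem Datum.twistedAct_diagAct {X N : Type*} [AddCommGroup X] [Module k X] [AddCommGroup N]
    [Module k N] (actX : X →ₗ[k] H →ₗ[k] X) (actN : A →ₗ[k] N →ₗ[k] N) (a : A)
    (f : C ⊗[k] X →ₗ[k] N) (c : C) (x : X) :
    D.twistedAct (D.diagAct actX) actN a f (c ⊗ₜ x) =
      TensorProduct.lift (((D.twistedAct actX actN).flip ∘ₗ TensorProduct.curry f ∘ₗ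
        D.act c).compr₂ (LinearMap.applyₗ x)) (D.coact a) := by
  -- Both sides are values of `Φ`: the left at `(Δ ⊗ A) ρ_A(a)`, the right at `(H ⊗ ρ_A) ρ_A(a)`.
  -- These agree by coassociativity.
  let Φ : (H ⊗[k] H) ⊗[k] A →ₗ[k] N :=
    TensorProduct.lift (actN.flip ∘ₗ f ∘ₗ TensorProduct.map (D.act c) (actX x))
  have h1 : ∀ y : H ⊗[k] A, TensorProduct.lift (actN.flip ∘ₗ f ∘ₗ D.diagAct actX (c ⊗ₜ x)) y =
      Φ ((Coalgebra.comul (R := k)).rTensor A y) := by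
    intro y
    induction y with
    | zero => simp
    | add y z hy hz => simp only [map_add, hy, hz]
    | tmul h b =>
      simp only [TensorProduct.lift.tmul, LinearMap.comp_apply, LinearMap.rTensor_tmul,
        D.diagAct_apply, Φ]
      rfl
  have h2 : ∀ y : H ⊗[k] A, TensorProduct.lift (((D.twistedAct actX actN).flip ∘ₗ
        TensorProduct.curry f ∘ₗ D.act c).compr₂ (LinearMap.applyₗ x)) y =
      Φ ((TensorProduct.assoc k H H A).symm (D.coact.toLinearMap.lTensor H y)) := by
    intro y
    induction y with
    | zero => simp
    | add y z hy hz => simp only [map_add, hy, hz]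
    | tmul h b =>
      simp only [TensorProduct.lift.tmul, LinearMap.compr₂_apply, LinearMap.comp_apply,
        LinearMap.flip_apply, LinearMap.applyₗ_apply_apply, D.twistedAct_apply,
        LinearMap.lTensor_tmul, AlgHom.toLinearMap_apply]
      generalize D.coact b = z
      induction z with
      | zero => simp
      | add y z hy hz => simp only [map_add, TensorProduct.tmul_add, hy, hz]
      | tmul h' b' => simp [Φ]
  rw [D.twistedAct_apply, h1, h2, ← D.coact_coassoc, LinearEquiv.symm_apply_apply]

theorem Datum.twistedAct_lTensor {X N : Type*} [AddCommGroup X] [Module k X] [AddCommGroup N]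
    [Module k N] (actX : X →ₗ[k] H →ₗ[k] X) (actN : A →ₗ[k] N →ₗ[k] N) (a : A)
    (f : X →ₗ[k] N) (c : C) (x : X) :
    D.twistedAct (D.diagAct actX) (LinearMap.lTensorHom C ∘ₗ actN) a (f.lTensor C) (c ⊗ₜ x) =
      TensorProduct.map (D.act c) (((D.twistedAct actX actN).flip f).flip x) (D.coact a) := by
  rw [D.twistedAct_diagAct]
  generalize D.coact a = y
  induction y with
  | zero => simp
  | add y z hy hz => simp only [map_add, hy, hz]
  | tmul h b =>
    simp only [TensorProduct.lift.tmul, LinearMap.compr₂_apply, LinearMap.comp_apply,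
        LinearMap.flip_apply, LinearMap.applyₗ_apply_apply, D.twistedAct_apply,
        TensorProduct.map_tmul]
    generalize D.coact b = z
    induction z with
    | zero => simp
    | add y z hy hz => simp only [map_add, TensorProduct.tmul_add, hy, hz]
    | tmul h' b' => simp

/-- Naturality of the twisted action in the `H`-module `X`; `Datum.map_twistedAct` is naturality in
the `A`-module `N`. -/
theorem Datum.twistedAct_comp {X Y N : Type*} [AddCommGroup X] [Module k X] [AddCommGroup Y]
    [Module k Y] [AddCommGroup N] [Module k N] (actX : X →ₗ[k] H →ₗ[k] X)
    (actY : Y →ₗ[k] H →ₗ[k] Y) (actN : A →ₗ[k] N →ₗ[k] N) (a : A) (f : Y →ₗ[k] N)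
    (e : X →ₗ[k] Y) (he : ∀ x h, e (actX x h) = actY (e x) h) (x : X) :
    D.twistedAct actX actN a (f ∘ₗ e) x = D.twistedAct actY actN a f (e x) := by
  rw [D.twistedAct_apply, D.twistedAct_apply]
  congr 2
  ext h b
  simp [he]

theorem Datum.map_twistedAct {X N N' : Type*} [AddCommGroup X] [Module k X] [AddCommGroup N]
    [Module k N] [AddCommGroup N'] [Module k N'] (actX : X →ₗ[k] H →ₗ[k] X)
    (actN : A →ₗ[k] N →ₗ[k] N) (actN' : A →ₗ[k] N' →ₗ[k] N') (a : A) (f : X →ₗ[k] N)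
    (e : N →ₗ[k] N') (he : ∀ a n, e (actN a n) = actN' a (e n)) (x : X) :
    e (D.twistedAct actX actN a f x) = D.twistedAct actX actN' a (e ∘ₗ f) x := by
  rw [D.twistedAct_apply, D.twistedAct_apply]
  generalize D.coact a = y
  induction y with
  | zero => simp
  | add y z hy hz => simp only [map_add, hy, hz]
  | tmul h b => simp [he]

/-- Compatibility of `Δ_C` with the `H`-action reduces this to coassociativity of `Δ_H`. It carries
centrality from `θ` to `λ`. -/
theorem Datum.tensorCoact_act₂ (x : C ⊗[k] C) (h : H) :
    tensorCoact k C C (D.act₂ x h) = D.diagAct D.act₂ (tensorCoact k C C x) h := by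
  induction x with
  | zero => simp
  | add x y hx hy => simp only [map_add, LinearMap.add_apply, hx, hy]
  | tmul c d =>
    have h1 : ∀ z : H ⊗[k] H, tensorCoact k C C (TensorProduct.map₂ D.act D.act (c ⊗ₜ d) z) =
        TensorProduct.assoc k C C C (TensorProduct.map (TensorProduct.map₂ D.act D.act
          (Coalgebra.comul (R := k) c)) (D.act d) ((Coalgebra.comul (R := k)).rTensor H z)) := by
      intro z
      induction z with
      | zero => simp
      | add x y hx hy => simp only [map_add, hx, hy]
      | tmul p q => simp [D.comul_act]
    have h2 : ∀ (z : H ⊗[k] H) (y : C ⊗[k] C), TensorProduct.map₂ D.act D.act₂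
        (TensorProduct.assoc k C C C (y ⊗ₜ d)) z =
        TensorProduct.assoc k C C C (TensorProduct.map (TensorProduct.map₂ D.act D.act y)
          (D.act d) ((TensorProduct.assoc k H H H).symm
            ((Coalgebra.comul (R := k)).lTensor H z))) := by
      intro z y
      induction z with
      | zero => simp
      | add x y hx hy => simp only [map_add, hx, hy]
      | tmul p q =>
        simp only [LinearMap.lTensor_tmul]
        induction y with
        | zero => simp
        | add x y hx hy => simp only [map_add, TensorProduct.add_tmul, LinearMap.add_apply,
            TensorProduct.map_add_left, hx, hy]
        | tmul c c' =>
          have h3 : D.act₂ (c' ⊗ₜ d) q =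
            TensorProduct.map (D.act c') (D.act d) (Coalgebra.comul (R := k) q) := rfl
          simp only [TensorProduct.assoc_tmul, TensorProduct.map₂_apply_tmul,
            TensorProduct.map_tmul, h3]
          generalize Coalgebra.comul (R := k) q = w
          induction w with
          | zero => simp
          | add x y hx hy => simp only [map_add, TensorProduct.tmul_add, hx, hy]
          | tmul q q' => simp
    rw [D.diagAct_apply, tensorCoact_tmul, h2, ← Coalgebra.coassoc_apply,
      LinearEquiv.symm_apply_apply, ← h1]
    rfl

theorem Datum.homLeft_one (f : C →ₗ[k] A) : D.homLeft 1 f = f := by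
  ext c
  rw [Datum.homLeft, D.twistedAct_apply, map_one, Algebra.TensorProduct.one_def]
  simp [D.act_one]

theorem Datum.homLeft_mul (a b : A) (f : C →ₗ[k] A) :
    D.homLeft (a * b) f = D.homLeft a (D.homLeft b f) := by
  ext c
  simp only [Datum.homLeft, D.twistedAct_apply, map_mul]
  generalize D.coact a = y
  induction y with
  | zero => simp
  | add y z hy hz => simp only [map_add, add_mul, hy, hz]
  | tmul h a =>
    simp only [TensorProduct.lift.tmul, LinearMap.comp_apply, LinearMap.flip_apply,
      LinearMap.mul_apply_apply, D.twistedAct_apply]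
    generalize D.coact b = z
    induction z with
    | zero => simp
    | add y z hy hz => simp only [map_add, mul_add, hy, hz]
    | tmul h' b => simp [D.act_mul, mul_assoc]

theorem Datum.homLeft_homRight (a b : A) (f : C →ₗ[k] A) :
    D.homLeft a (D.homRight f b) = D.homRight (D.homLeft a f) b := by
  ext c
  exact (D.map_twistedAct _ _ _ a f (LinearMap.mulRight k b)
    (fun a n => by simp [mul_assoc]) c).symm

end Twisted

/-! ### The five descriptions of a total integral. -/

section Equivalences

variable {k H A C : Type u} [CommRing k] [Ring H] [Bialgebra k H] [Ring A] [Algebra k A]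
  [AddCommGroup C] [Module k C] [Coalgebra k C] (D : Datum k H A C)

/-- The map `ε_C ⊗ M : C ⊗ M → M`. -/
noncomputable def counitTensor (k C M : Type*) [CommRing k] [AddCommGroup C] [Module k C]
    [Coalgebra k C] [AddCommGroup M] [Module k M] : C ⊗[k] M →ₗ[k] M :=
  (TensorProduct.lid k M).toLinearMap ∘ₗ (Coalgebra.counit (R := k)).rTensor M

@[simp] theorem counitTensor_tmul (k C M : Type*) [CommRing k] [AddCommGroup C] [Module k C]
    [Coalgebra k C] [AddCommGroup M] [Module k M] (c : C) (m : M) :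
    counitTensor k C M (c ⊗ₜ m) = Coalgebra.counit (R := k) c • m := rfl

theorem counitTensor_lTensor {k C M N : Type*} [CommRing k] [AddCommGroup C] [Module k C]
    [Coalgebra k C] [AddCommGroup M] [Module k M] [AddCommGroup N] [Module k N] (f : M →ₗ[k] N)
    (x : C ⊗[k] M) : counitTensor k C N (f.lTensor C x) = f (counitTensor k C M x) := by
  induction x with
  | zero => simp
  | add x y hx hy => simp only [map_add, hx, hy]
  | tmul c m => simp

theorem counitTensor_tensorCoact (k C M : Type*) [CommRing k] [AddCommGroup C] [Module k C]
    [Coalgebra k C] [AddCommGroup M] [Module k M] (x : C ⊗[k] M) :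
    counitTensor k C (C ⊗[k] M) (tensorCoact k C M x) = x :=
  (tensorCoact_isLeftCoaction k C M).counit x

theorem lTensor_counitTensor_tensorCoact (k C M : Type*) [CommRing k] [AddCommGroup C]
    [Module k C] [Coalgebra k C] [AddCommGroup M] [Module k M] (x : C ⊗[k] M) :
    (counitTensor k C M).lTensor C (tensorCoact k C M x) = x := by
  induction x with
  | zero => simp
  | add x y hx hy => simp only [map_add, hx, hy]
  | tmul c m =>
    have h : ∀ y : C ⊗[k] C, (counitTensor k C M).lTensor C (TensorProduct.assoc k C C M (y ⊗ₜ m)) =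
        TensorProduct.rid k C ((Coalgebra.counit (R := k)).lTensor C y) ⊗ₜ m := by
      intro y
      induction y with
      | zero => simp
      | add x y hx hy => simp only [map_add, TensorProduct.add_tmul, hx, hy]
      | tmul a b => simp [TensorProduct.smul_tmul]
    rw [tensorCoact_tmul, h, Coalgebra.lTensor_counit_comul]
    simp

theorem tensorCoact_lTensor {k C M N : Type*} [CommRing k] [AddCommGroup C] [Module k C]
    [Coalgebra k C] [AddCommGroup M] [Module k M] [AddCommGroup N] [Module k N] (f : M →ₗ[k] N)
    (x : C ⊗[k] M) : tensorCoact k C N (f.lTensor C x) =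
      (f.lTensor C).lTensor C (tensorCoact k C M x) := by
  induction x with
  | zero => simp
  | add x y hx hy => simp only [map_add, hx, hy]
  | tmul c m =>
    simp only [LinearMap.lTensor_tmul, tensorCoact_tmul]
    generalize Coalgebra.comul (R := k) c = z
    induction z with
    | zero => simp
    | add x y hx hy => simp only [map_add, TensorProduct.add_tmul, hx, hy]
    | tmul a b => simp

theorem tensorCoact_tensorCoact {k C M : Type*} [CommRing k] [AddCommGroup C] [Module k C]
    [Coalgebra k C] [AddCommGroup M] [Module k M] (x : C ⊗[k] M) :
    tensorCoact k C (C ⊗[k] M) (tensorCoact k C M x) =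
      (tensorCoact k C M).lTensor C (tensorCoact k C M x) :=
  (tensorCoact_isLeftCoaction k C M).coassoc x

theorem lTensor_tensorCoact_tmul {k C M N : Type*} [CommRing k] [AddCommGroup C] [Module k C]
    [Coalgebra k C] [AddCommGroup M] [Module k M] [AddCommGroup N] [Module k N]
    (f : C ⊗[k] M →ₗ[k] N) (c : C) (m : M) :
    f.lTensor C (tensorCoact k C M (c ⊗ₜ m)) =
      ((TensorProduct.curry f).flip m).lTensor C (Coalgebra.comul (R := k) c) := by
  rw [tensorCoact_tmul]
  generalize Coalgebra.comul (R := k) c = z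
  induction z with
  | zero => simp
  | add x y hx hy => simp only [map_add, TensorProduct.add_tmul, hx, hy]
  | tmul a b => simp

/-- Since `ε_C(c · h) = ε(c) ε(h)`, applying `ε_C` leaves the action of `∑ ε(a₍₋₁₎) a₍₀₎ = a`. -/
theorem Datum.counitTensor_pairAct (M : Type*) [AddCommGroup M] [Module k M] [Module Aᵐᵒᵖ M]
    [IsScalarTower k Aᵐᵒᵖ M] (x : C ⊗[k] M) (a : A) :
    counitTensor k C M (D.pairAct M x (D.coact a)) =
      MulOpposite.op a • counitTensor k C M x := by
  have h : ∀ z : H ⊗[k] A, counitTensor k C M (D.pairAct M x z) =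
      rightMul k A M (counitTensor k C M x) (counitTensor k H A z) := by
    intro z
    induction x with
    | zero => simp
    | add x y hx hy => simp only [map_add, LinearMap.add_apply, hx, hy]
    | tmul c m =>
      induction z with
      | zero => simp
      | add x y hx hy => simp only [map_add, hx, hy]
      | tmul h a =>
        simp only [pairAct_tmul, counitTensor_tmul, D.counit_act, map_smul, LinearMap.smul_apply,
          rightMul_apply, mul_smul]
        rw [smul_comm]
  rw [h]
  exact congrArg (rightMul k A M _) (D.coact_counit a)

theorem Datum.pairAct_lTensor {M N : Type*} [AddCommGroup M] [Module k M] [Module Aᵐᵒᵖ M]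
    [IsScalarTower k Aᵐᵒᵖ M] [AddCommGroup N] [Module k N] [Module Aᵐᵒᵖ N]
    [IsScalarTower k Aᵐᵒᵖ N] (f : M →ₗ[k] N)
    (hf : ∀ (a : A) m, f (MulOpposite.op a • m) = MulOpposite.op a • f m) (x : C ⊗[k] M)
    (z : H ⊗[k] A) : f.lTensor C (D.pairAct M x z) = D.pairAct N (f.lTensor C x) z := by
  induction x with
  | zero => simp
  | add x y hx hy => simp only [map_add, LinearMap.add_apply, hx, hy]
  | tmul c m =>
    induction z with
    | zero => simp
    | add x y hx hy => simp only [map_add, hx, hy]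
    | tmul h a => simp [hf]

/-- `ε_C ⊗ ρ_A` factors as `ρ_A ∘ (ε_C ⊗ A)`, so the spread conditions of `V₁` and `V₂` see only the
composite with `ε_C ⊗ A`. -/
theorem Datum.spreadCA_eq_spread (g : C →ₗ[k] C ⊗[k] A) (d : C) :
    D.spreadCA g d = D.spread (counitTensor k C A ∘ₗ g) d := by
  have h : D.counitCoact = D.coact.toLinearMap ∘ₗ counitTensor k C A := by
    ext c a
    simp [Datum.counitCoact]
  rw [Datum.spreadCA, Datum.spread, h, LinearMap.comp_assoc]

theorem Datum.twistedAct_act₂_lift (γ : C →ₗ[k] C →ₗ[k] A) (a : A) (c d : C) :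
    D.twistedAct D.act₂ (LinearMap.mul k A) a (TensorProduct.lift γ) (c ⊗ₜ d) =
      D.twistedAct D.act D.homLeft a γ c d := by
  have h : TensorProduct.curry (TensorProduct.lift γ) = γ := by ext; simp
  rw [D.act₂_eq_diagAct, D.twistedAct_diagAct, TensorProduct.lift_compr₂, D.twistedAct_apply, h]
  rfl

theorem Datum.isV₃_lift_iff (γ : C →ₗ[k] C →ₗ[k] A) :
    IsV₃ D (TensorProduct.lift γ) ↔ IsIntegral D γ := by
  have h1 : ∀ c, TensorProduct.lift γ ∘ₗ TensorProduct.mk k C C c = γ c := fun c => by ext; simp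
  have h2 : TensorProduct.curry (TensorProduct.lift γ) = γ := by ext; simp
  constructor
  · intro h
    refine ⟨fun a c => ?_, fun c d => ?_⟩
    · ext d
      rw [← D.twistedAct_act₂_lift, ← h.central]
      rfl
    · have := h.spread c d
      rwa [lTensor_tensorCoact_tmul, h1, h2] at this
  · intro h
    refine ⟨fun c d a => ?_, fun c d => ?_⟩
    · rw [D.twistedAct_act₂_lift, h.central]
      rfl
    · rw [lTensor_tensorCoact_tmul, h1, h2]
      exact h.spread c d

theorem Datum.leftCA_tmul (a b : A) (c : C) : D.leftCA a (c ⊗ₜ b) = c ⊗ₜ (a * b) := rfl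

theorem Datum.leftCA_mul (a b : A) (x : C ⊗[k] A) :
    D.leftCA (a * b) x = D.leftCA a (D.leftCA b x) := by
  induction x with
  | zero => simp
  | add x y hx hy => simp only [map_add, hx, hy]
  | tmul c d => simp [D.leftCA_tmul, mul_assoc]

theorem Datum.leftCA_one (x : C ⊗[k] A) : D.leftCA 1 x = x := by
  induction x with
  | zero => simp
  | add x y hx hy => simp only [map_add, hx, hy]
  | tmul c d => simp [D.leftCA_tmul]

theorem Datum.leftCA_pairAct (a : A) (x : C ⊗[k] A) (z : H ⊗[k] A) :
    D.leftCA a (D.pairAct A x z) = D.pairAct A (D.leftCA a x) z :=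
  D.pairAct_lTensor (LinearMap.mul k A a) (fun b m => by simp [mul_assoc]) x z

theorem Datum.counitTensor_leftCA (a : A) (x : C ⊗[k] A) :
    counitTensor k C A (D.leftCA a x) = a * counitTensor k C A x :=
  counitTensor_lTensor (LinearMap.mul k A a) x

/-- Cofreeness of `C ⊗ A`: apply `C ⊗ ε ⊗ A` to the colinearity identity. This makes the spread
conditions of `V₂` and `V₃` the same equation. -/
theorem IsV₂.eq_lTensor {D : Datum k H A C} {l : C ⊗[k] C →ₗ[k] C ⊗[k] A} (hl : IsV₂ D l) :
    l = (counitTensor k C A ∘ₗ l).lTensor C ∘ₗ tensorCoact k C C := by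
  ext c d
  simp only [TensorProduct.AlgebraTensorModule.curry_apply, LinearMap.restrictScalars_self,
    TensorProduct.curry_apply, LinearMap.comp_apply, LinearMap.lTensor_comp_apply, hl.colinear,
    lTensor_counitTensor_tensorCoact]

theorem IsV₂.isV₃ {D : Datum k H A C} {l : C ⊗[k] C →ₗ[k] C ⊗[k] A} (hl : IsV₂ D l) :
    IsV₃ D (counitTensor k C A ∘ₗ l) where
  central c d a := by
    rw [← D.map_twistedAct _ _ _ a l (counitTensor k C A) D.counitTensor_leftCA, hl.central,
      D.counitTensor_pairAct]
    rfl
  spread c d := by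
    rw [LinearMap.comp_assoc, ← D.spreadCA_eq_spread, hl.spread]
    exact congrArg (fun f => f (c ⊗ₜ d)) hl.eq_lTensor.symm

theorem IsV₃.isV₂ {D : Datum k H A C} {θ : C ⊗[k] C →ₗ[k] A} (hθ : IsV₃ D θ) :
    IsV₂ D (θ.lTensor C ∘ₗ tensorCoact k C C) where
  spread c d := by
    have h : counitTensor k C A ∘ₗ (θ.lTensor C ∘ₗ tensorCoact k C C) ∘ₗ TensorProduct.mk k C C c =
        θ ∘ₗ TensorProduct.mk k C C c := by
      ext d
      simp only [LinearMap.comp_apply, counitTensor_lTensor, counitTensor_tensorCoact]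
    rw [D.spreadCA_eq_spread, h, ← hθ.spread]
    rfl
  central a c d := by
    rw [D.twistedAct_comp D.act₂ (D.diagAct D.act₂) _ _ _ _ D.tensorCoact_act₂,
      LinearMap.comp_apply, tensorCoact_tmul]
    generalize Coalgebra.comul (R := k) c = z
    induction z with
    | zero => simp
    | add x y hx hy =>
      simp only [map_add, TensorProduct.add_tmul, LinearMap.add_apply, hx, hy]
    | tmul p q =>
      have h : ((D.twistedAct D.act₂ (LinearMap.mul k A)).flip θ).flip (q ⊗ₜ d) =
          rightMul k A A (θ (q ⊗ₜ d)) := by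
        ext a
        exact (hθ.central q d a).symm
      rw [TensorProduct.assoc_tmul, Datum.leftCA, D.twistedAct_lTensor, h]
      rfl
  colinear c d := by
    simp only [LinearMap.comp_apply, tensorCoact_lTensor, tensorCoact_tensorCoact,
      LinearMap.lTensor_comp_apply]

/-- By coassociativity of `ρ_A`, the iterated action on `C ⊗ (C ⊗ A)` is the diagonal action on the
two copies of `C`. -/
theorem Datum.pairAct_CA (c d : C) (b a : A) :
    D.pairAct D.CA.carrier (c ⊗ₜ[k] (d ⊗ₜ[k] b : C ⊗[k] A)) (D.coact a) =
      TensorProduct.assoc k C C A (TensorProduct.map (D.act₂ (c ⊗ₜ d)) (rightMul k A A b)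
        (D.coact a)) :=
  (D.tensorCoact_pairAct A c d b a).symm

/-- The extension `c ⊗ d ⊗ a ↦ a l(c ⊗ d)`. -/
noncomputable def Datum.extend (l : C ⊗[k] C →ₗ[k] C ⊗[k] A) :
    C ⊗[k] (C ⊗[k] A) →ₗ[k] C ⊗[k] A :=
  TensorProduct.lift (D.leftCA.flip ∘ₗ l) ∘ₗ (TensorProduct.assoc k C C A).symm.toLinearMap

theorem Datum.extend_tmul (l : C ⊗[k] C →ₗ[k] C ⊗[k] A) (c d : C) (a : A) :
    D.extend l (c ⊗ₜ (d ⊗ₜ a)) = D.leftCA a (l (c ⊗ₜ d)) := rfl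

theorem Datum.extend_assoc (l : C ⊗[k] C →ₗ[k] C ⊗[k] A) (x : C ⊗[k] C) (a : A) :
    D.extend l (TensorProduct.assoc k C C A (x ⊗ₜ a)) = D.leftCA a (l x) := by
  simp [Datum.extend]

theorem Datum.extend_pairAct (l : C ⊗[k] C →ₗ[k] C ⊗[k] A) (c d : C) (b a : A) :
    D.extend l (D.pairAct D.CA.carrier (c ⊗ₜ[k] (d ⊗ₜ[k] b : C ⊗[k] A)) (D.coact a)) =
      D.leftCA b (D.twistedAct D.act₂ D.leftCA a l (c ⊗ₜ d)) := by
  rw [D.pairAct_CA, D.twistedAct_apply]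
  generalize D.coact a = z
  induction z with
  | zero => simp
  | add x y hx hy => simp only [map_add, hx, hy]
  | tmul h a' =>
    rw [TensorProduct.map_tmul, D.extend_assoc]
    simp [D.leftCA_mul]

theorem Datum.extend_colinear (l : C ⊗[k] C →ₗ[k] C ⊗[k] A)
    (hl : ∀ c d : C, l.lTensor C (tensorCoact k C C (c ⊗ₜ d)) = tensorCoact k C A (l (c ⊗ₜ d)))
    (x : C ⊗[k] (C ⊗[k] A)) :
    tensorCoact k C A (D.extend l x) =
      (D.extend l).lTensor C (tensorCoact k C (C ⊗[k] A) x) := by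
  induction x with
  | zero => simp
  | add x y hx hy => simp only [map_add, hx, hy]
  | tmul c y =>
    induction y with
    | zero => simp
    | add x y hx hy => simp only [map_add, TensorProduct.tmul_add, hx, hy]
    | tmul d a =>
      have h : tensorCoact k C A (D.leftCA a (l (c ⊗ₜ d))) =
          (D.leftCA a).lTensor C (tensorCoact k C A (l (c ⊗ₜ d))) :=
        tensorCoact_lTensor (LinearMap.mul k A a) _
      rw [D.extend_tmul, h, ← hl, ← LinearMap.lTensor_comp_apply, tensorCoact_tmul,
        tensorCoact_tmul]
      generalize Coalgebra.comul (R := k) c = z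
      induction z with
      | zero => simp
      | add x y hx hy => simp only [map_add, TensorProduct.add_tmul, hx, hy]
      | tmul p q => simp [D.extend_tmul]

theorem Datum.pairAct_extend (l : C ⊗[k] C →ₗ[k] C ⊗[k] A)
    (hl : ∀ (a : A) (c d : C), D.twistedAct D.act₂ D.leftCA a l (c ⊗ₜ d) =
      D.pairAct A (l (c ⊗ₜ d)) (D.coact a)) (x : C ⊗[k] (C ⊗[k] A)) (a : A) :
    D.extend l (D.pairAct D.CA.carrier x (D.coact a)) =
      D.pairAct A (D.extend l x) (D.coact a) := by
  -- The carrier of `D.CA` unfolds to `C ⊗[k] A`; giving the action this type lets `ext` reduce to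
  -- pure tensors.
  let R : C ⊗[k] (C ⊗[k] A) →ₗ[k] C ⊗[k] (C ⊗[k] A) :=
    (D.pairAct D.CA.carrier).flip (D.coact a)
  have h : D.extend l ∘ₗ R = (D.pairAct A).flip (D.coact a) ∘ₗ D.extend l := by
    ext c d b
    refine (D.extend_pairAct l c d b a).trans ?_
    rw [hl, D.leftCA_pairAct]
    rfl
  exact LinearMap.congr_fun h x

/-- The morphism of Doi-Hopf modules `c ⊗ d ⊗ a ↦ a l(c ⊗ d)`. -/
noncomputable def IsV₂.hom {D : Datum k H A C} {l : C ⊗[k] C →ₗ[k] C ⊗[k] A} (hl : IsV₂ D l) :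
    D.CCA ⟶ D.CA where
  toLinearMap :=
    { toFun := D.extend l
      map_add' := map_add _
      map_smul' := fun a x => D.pairAct_extend l hl.central x a.unop }
  colinear := D.extend_colinear l hl.colinear

theorem IsV₂.underlying_hom {D : Datum k H A C} {l : C ⊗[k] C →ₗ[k] C ⊗[k] A} (hl : IsV₂ D l) :
    D.underlying hl.hom = D.extend l := rfl

theorem IsV₂.isV₁ {D : Datum k H A C} {l : C ⊗[k] C →ₗ[k] C ⊗[k] A} (hl : IsV₂ D l) :
    IsV₁ D hl.hom where
  left_linear a b c d := by
    rw [hl.underlying_hom, D.extend_tmul, D.extend_tmul, D.leftCA_mul]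
  spread c d := by
    have h : D.extend l ∘ₗ TensorProduct.mk k C (C ⊗[k] A) c ∘ₗ
      (TensorProduct.mk k C A).flip 1 = l ∘ₗ TensorProduct.mk k C C c := by
      ext d
      simp [D.extend_tmul, D.leftCA_one]
    rw [hl.underlying_hom, h, hl.spread, D.extend_tmul, D.leftCA_one]

theorem IsV₂.isNormalized₁ {D : Datum k H A C} {l : C ⊗[k] C →ₗ[k] C ⊗[k] A} (hl : IsV₂ D l)
    (h : IsNormalized₂ D l) : IsNormalized₁ D hl.hom := fun c a => by
  rw [hl.underlying_hom, tensorCoact_tmul, D.extend_assoc, h, D.leftCA_tmul, mul_one]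

/-- The restriction `c ⊗ d ↦ ν(c ⊗ d ⊗ 1)`. -/
noncomputable def Datum.restrict (ν : D.CCA ⟶ D.CA) : C ⊗[k] C →ₗ[k] C ⊗[k] A :=
  D.underlying ν ∘ₗ ((TensorProduct.mk k C A).flip 1).lTensor C

theorem IsV₁.extend_restrict {D : Datum k H A C} {ν : D.CCA ⟶ D.CA} (hν : IsV₁ D ν) :
    D.extend (D.restrict ν) = D.underlying ν := by
  ext c d a
  simpa [D.extend_tmul, Datum.restrict] using (hν.left_linear 1 a c d).symm

theorem IsV₁.isV₂ {D : Datum k H A C} {ν : D.CCA ⟶ D.CA} (hν : IsV₁ D ν) :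
    IsV₂ D (D.restrict ν) where
  spread c d := hν.spread c d
  central a c d := by
    have h : D.underlying ν (D.pairAct D.CA.carrier (c ⊗ₜ[k] (d ⊗ₜ[k] 1 : C ⊗[k] A))
        (D.coact a)) = D.pairAct A (D.underlying ν (c ⊗ₜ (d ⊗ₜ 1))) (D.coact a) :=
      ν.toLinearMap.map_smul (MulOpposite.op a) _
    -- Once `ν` is the extension of its restriction, right `A`-linearity at `c ⊗ d ⊗ 1` is exactly
    -- centrality.
    rw [← hν.extend_restrict, D.extend_pairAct, D.leftCA_one] at h
    rw [h, D.extend_tmul, D.leftCA_one]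
  colinear c d := by
    have h : tensorCoact k C A (D.underlying ν (c ⊗ₜ (d ⊗ₜ 1))) =
      (D.underlying ν).lTensor C (tensorCoact k C (C ⊗[k] A) (c ⊗ₜ (d ⊗ₜ 1))) := ν.colinear _
    rw [Datum.restrict, LinearMap.lTensor_comp_apply, ← tensorCoact_lTensor]
    exact h.symm

theorem IsNormalized₁.isNormalized₂ {D : Datum k H A C} {ν : D.CCA ⟶ D.CA}
    (h : IsNormalized₁ D ν) : IsNormalized₂ D (D.restrict ν) := fun c => by
  have e : ∀ y : C ⊗[k] C, ((TensorProduct.mk k C A).flip 1).lTensor C y =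
      TensorProduct.assoc k C C A (y ⊗ₜ 1) := by
    intro y
    induction y with
    | zero => simp
    | add x y hx hy => simp only [map_add, TensorProduct.add_tmul, hx, hy]
    | tmul p q => simp
  rw [Datum.restrict, LinearMap.comp_apply, e, ← tensorCoact_tmul, h]

theorem IsNormalized₂.isNormalized₃ {D : Datum k H A C} {l : C ⊗[k] C →ₗ[k] C ⊗[k] A}
    (h : IsNormalized₂ D l) : IsNormalized₃ D (counitTensor k C A ∘ₗ l) := fun c => by
  rw [LinearMap.comp_apply, h, counitTensor_tmul, Algebra.algebraMap_eq_smul_one]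

/-- By coassociativity, `∑ c₍₁₎ ⊗ θ(c₍₂₎ ⊗ c₍₃₎) = ∑ c₍₁₎ ⊗ ε(c₍₂₎) 1 = c ⊗ 1`. -/
theorem IsNormalized₃.isNormalized₂ {D : Datum k H A C} {θ : C ⊗[k] C →ₗ[k] A}
    (h : IsNormalized₃ D θ) : IsNormalized₂ D (θ.lTensor C ∘ₗ tensorCoact k C C) := fun c => by
  have e : ∀ y : C ⊗[k] C, tensorCoact k C C y = TensorProduct.assoc k C C C
    ((Coalgebra.comul (R := k)).rTensor C y) := fun y => rfl
  have h' : θ ∘ₗ Coalgebra.comul (R := k) =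
      Algebra.linearMap k A ∘ₗ Coalgebra.counit (R := k) := LinearMap.ext h
  rw [LinearMap.comp_apply, e, Coalgebra.coassoc_apply, ← LinearMap.lTensor_comp_apply, h',
    LinearMap.lTensor_comp_apply, Coalgebra.lTensor_counit_comul]
  simp

/-- The extension `c ⊗ a ↦ a · γ(c)`. -/
noncomputable def Datum.extendHom (γ : C →ₗ[k] C →ₗ[k] A) : C ⊗[k] A →ₗ[k] C →ₗ[k] A :=
  TensorProduct.lift (D.homLeft.flip ∘ₗ γ)

theorem Datum.extendHom_comp (γ : C →ₗ[k] C →ₗ[k] A) :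
    D.extendHom γ ∘ₗ (TensorProduct.mk k C A).flip 1 = γ :=
  LinearMap.ext fun c => D.homLeft_one (γ c)

theorem Datum.extendHom_leftCA (γ : C →ₗ[k] C →ₗ[k] A) (a : A) (x : C ⊗[k] A) :
    D.extendHom γ (D.leftCA a x) = D.homLeft a (D.extendHom γ x) := by
  induction x with
  | zero => simp
  | add x y hx hy => simp only [map_add, hx, hy]
  | tmul c b => exact D.homLeft_mul a b (γ c)

theorem Datum.extendHom_pairAct (γ : C →ₗ[k] C →ₗ[k] A) (c : C) (b a : A) :
    D.extendHom γ (D.pairAct A (c ⊗ₜ b) (D.coact a)) =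
      D.homLeft b (D.twistedAct D.act D.homLeft a γ c) := by
  rw [D.twistedAct_apply]
  generalize D.coact a = z
  induction z with
  | zero => simp
  | add x y hx hy => simp only [map_add, hx, hy]
  | tmul h a' => exact D.homLeft_mul b a' _

theorem IsIntegral.isV₅ {D : Datum k H A C} {γ : C →ₗ[k] C →ₗ[k] A} (hγ : IsIntegral D γ) :
    IsV₅ D (D.extendHom γ) where
  left_linear := D.extendHom_leftCA γ
  right_linear a x := by
    induction x with
    | zero => simp [Datum.homRight]
    | add x y hx hy =>
      simp only [map_add, LinearMap.add_apply, hx, hy]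
      exact (LinearMap.comp_add _ _ _).symm
    | tmul c b =>
      rw [D.extendHom_pairAct, hγ.central, D.homLeft_homRight]
      rfl
  spread c d := by
    have h : D.extendHom γ (c ⊗ₜ 1) = γ c := D.homLeft_one (γ c)
    rw [D.extendHom_comp, h]
    exact hγ.spread c d

theorem IsV₅.isIntegral {D : Datum k H A C} {ψ : C ⊗[k] A →ₗ[k] C →ₗ[k] A} (hψ : IsV₅ D ψ) :
    IsIntegral D (ψ ∘ₗ (TensorProduct.mk k C A).flip 1) where
  central a c := by
    -- Left linearity recovers `ψ` from its values at `c ⊗ 1`; right linearity at `c ⊗ 1` is then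
    -- centrality.
    have h : D.extendHom (ψ ∘ₗ (TensorProduct.mk k C A).flip 1) = ψ := by
      refine TensorProduct.ext' fun c a => ?_
      have := hψ.left_linear a (c ⊗ₜ 1)
      rw [D.leftCA_tmul, mul_one] at this
      rw [this]
      rfl
    have h' := D.extendHom_pairAct (ψ ∘ₗ (TensorProduct.mk k C A).flip 1) c 1 a
    rw [D.homLeft_one, h, hψ.right_linear] at h'
    exact h'.symm
  spread := hψ.spread

/-- The equivalent descriptions of a total integral. -/
theorem Datum.totalIntegral_tfae : List.TFAE [
      ∃ γ : C →ₗ[k] C →ₗ[k] A, IsTotalIntegral D γ,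
      ∃ ν : D.CCA ⟶ D.CA, IsV₁ D ν ∧ IsNormalized₁ D ν,
      ∃ l : C ⊗[k] C →ₗ[k] C ⊗[k] A, IsV₂ D l ∧ IsNormalized₂ D l,
      ∃ θ : C ⊗[k] C →ₗ[k] A, IsV₃ D θ ∧ IsNormalized₃ D θ,
      ∃ ψ : C ⊗[k] A →ₗ[k] C →ₗ[k] A, IsV₅ D ψ ∧ IsNormalized₅ D ψ] := by
  tfae_have 1 → 4
  | ⟨γ, hγ⟩ => ⟨_, (D.isV₃_lift_iff γ).2 hγ.toIsIntegral, hγ.normalized⟩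
  tfae_have 4 → 1
  | ⟨θ, h, h'⟩ => by
    have e : TensorProduct.lift (TensorProduct.curry θ) = θ := by ext; simp
    rw [← e] at h h'
    exact ⟨_, (D.isV₃_lift_iff _).1 h, h'⟩
  tfae_have 4 → 3
  | ⟨_, h, h'⟩ => ⟨_, h.isV₂, h'.isNormalized₂⟩
  tfae_have 3 → 4
  | ⟨_, h, h'⟩ => ⟨_, h.isV₃, h'.isNormalized₃⟩
  tfae_have 3 → 2
  | ⟨_, h, h'⟩ => ⟨_, h.isV₁, h.isNormalized₁ h'⟩
  tfae_have 2 → 3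
  | ⟨_, h, h'⟩ => ⟨_, h.isV₂, h'.isNormalized₂⟩
  tfae_have 1 → 5
  | ⟨γ, hγ⟩ => ⟨_, hγ.toIsIntegral.isV₅, fun c => by
      rw [D.extendHom_comp]
      exact hγ.normalized c⟩
  tfae_have 5 → 1
  | ⟨_, h, h'⟩ => ⟨_, h.isIntegral, h'⟩
  tfae_finish

end Equivalences

/-! ### The adjunction with `C ⊗ -` and the averaging map attached to `θ`. -/

section Induction

variable {k H A C : Type u} [CommRing k] [Ring H] [Bialgebra k H] [Ring A] [Algebra k A]
  [AddCommGroup C] [Module k C] [Coalgebra k C] (D : Datum k H A C)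

@[simp] theorem DHModule.comp_toLinearMap {D : Datum k H A C} {M N P : DHModule D} (f : M ⟶ N)
    (g : N ⟶ P) : DHModule.Hom.toLinearMap (f ≫ g) = g.toLinearMap ∘ₗ f.toLinearMap := rfl

@[simp] theorem DHModule.id_toLinearMap {D : Datum k H A C} (M : DHModule D) :
    DHModule.Hom.toLinearMap (𝟙 M) = LinearMap.id := rfl

@[simp] theorem DHModule.zero_toLinearMap {D : Datum k H A C} (M N : DHModule D) :
    DHModule.Hom.toLinearMap (0 : M ⟶ N) = 0 := rfl

theorem DHModule.hom_ext {D : Datum k H A C} {M N : DHModule D} {f g : M ⟶ N}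
    (h : ∀ m, f.toLinearMap m = g.toLinearMap m) : f = g :=
  DHModule.Hom.ext (LinearMap.ext h)

theorem DHModule.comp_apply {D : Datum k H A C} {M N P : DHModule D} {f : M ⟶ N} {g : N ⟶ P}
    {h : M ⟶ P} (e : f ≫ g = h) (m : M.carrier) :
    g.toLinearMap (f.toLinearMap m) = h.toLinearMap m := by
  rw [← e]
  rfl

/-- The functoriality of the induced Doi-Hopf module `C ⊗ M`. -/
noncomputable def Datum.inducedMap {M N : Type u} [AddCommGroup M] [Module k M] [Module Aᵐᵒᵖ M]
    [IsScalarTower k Aᵐᵒᵖ M] [AddCommGroup N] [Module k N] [Module Aᵐᵒᵖ N]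
    [IsScalarTower k Aᵐᵒᵖ N] (f : M →ₗ[Aᵐᵒᵖ] N) : D.induced M ⟶ D.induced N where
  toLinearMap :=
    { toFun := (f.restrictScalars k).lTensor C
      map_add' := map_add _
      map_smul' := fun a x => D.pairAct_lTensor (f.restrictScalars k)
        (fun a m => f.map_smul (MulOpposite.op a) m) x (D.coact a.unop) }
  colinear x := tensorCoact_lTensor (f.restrictScalars k) x

/-- The coaction of a Doi-Hopf module `M` as a morphism `M ⟶ C ⊗ M`. -/
noncomputable def DHModule.coactHom {D : Datum k H A C} (M : DHModule D) :
    M ⟶ D.induced M.carrier where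
  toLinearMap :=
    { toFun := M.coact
      map_add' := map_add _
      map_smul' := fun a m => M.coact_smul m a.unop }
  colinear := M.isLeftCoaction.coassoc

/-- The counit `C ⊗ M → M`, as a right `A`-linear map. -/
noncomputable def Datum.counitLinear (M : Type u) [AddCommGroup M] [Module k M] [Module Aᵐᵒᵖ M]
    [IsScalarTower k Aᵐᵒᵖ M] : (D.induced M).carrier →ₗ[Aᵐᵒᵖ] M where
  toFun := counitTensor k C M
  map_add' := map_add _
  map_smul' a x := D.counitTensor_pairAct M x a.unop

theorem DHModule.counitTensor_coact {D : Datum k H A C} (M : DHModule D) (m : M.carrier) :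
    counitTensor k C M.carrier (M.coact m) = m :=
  M.isLeftCoaction.counit m

/-- A map `θ : C ⊗ C → A` induces `c ⊗ d ⊗ n ↦ n θ(c ⊗ d)` on `C ⊗ C ⊗ N`. -/
noncomputable def Datum.act₂Lift (_ : Datum k H A C) (θ : C ⊗[k] C →ₗ[k] A) (N : Type*)
    [AddCommGroup N] [Module k N] [Module Aᵐᵒᵖ N] [IsScalarTower k Aᵐᵒᵖ N] :
    C ⊗[k] (C ⊗[k] N) →ₗ[k] N :=
  TensorProduct.lift ((rightMul k A N).flip ∘ₗ θ) ∘ₗ (TensorProduct.assoc k C C N).symm.toLinearMap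

section act₂Lift

variable (θ : C ⊗[k] C →ₗ[k] A) (N : Type*)
    [AddCommGroup N] [Module k N] [Module Aᵐᵒᵖ N] [IsScalarTower k Aᵐᵒᵖ N]

@[simp] theorem Datum.act₂Lift_tmul (c d : C) (n : N) :
    D.act₂Lift θ N (c ⊗ₜ (d ⊗ₜ n)) = MulOpposite.op (θ (c ⊗ₜ d)) • n := rfl

theorem Datum.act₂Lift_assoc (y : C ⊗[k] C) (n : N) :
    D.act₂Lift θ N (TensorProduct.assoc k C C N (y ⊗ₜ n)) = MulOpposite.op (θ y) • n := by
  simp [Datum.act₂Lift]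

end act₂Lift

/-- The map `c ⊗ n ↦ ∑ n₍₀₎ θ(c ⊗ n₍₋₁₎)`. -/
noncomputable def DHModule.averageLinear {D : Datum k H A C} (θ : C ⊗[k] C →ₗ[k] A)
    (N : DHModule D) : C ⊗[k] N.carrier →ₗ[k] N.carrier :=
  D.act₂Lift θ N.carrier ∘ₗ N.coact.lTensor C

/-- On `c ⊗ d ⊗ n` the left side is `n · ∑ a₍₀₎ θ(c · a₍₋₂₎ ⊗ d · a₍₋₁₎)`, and centrality turns this
into `n θ(c ⊗ d) a`. -/
theorem IsV₃.act₂Lift_pairAct {D : Datum k H A C} {θ : C ⊗[k] C →ₗ[k] A} (hθ : IsV₃ D θ)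
    (N : Type u) [AddCommGroup N] [Module k N] [Module Aᵐᵒᵖ N] [IsScalarTower k Aᵐᵒᵖ N]
    (x : C ⊗[k] (C ⊗[k] N)) (a : A) :
    D.act₂Lift θ N (D.pairAct (D.induced N).carrier x (D.coact a)) =
      MulOpposite.op a • D.act₂Lift θ N x := by
  let R : C ⊗[k] (C ⊗[k] N) →ₗ[k] C ⊗[k] (C ⊗[k] N) :=
    (D.pairAct (D.induced N).carrier).flip (D.coact a)
  have h : D.act₂Lift θ N ∘ₗ R = (rightMul k A N).flip a ∘ₗ D.act₂Lift θ N := by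
    ext c d n
    refine (congrArg (D.act₂Lift θ N) (D.tensorCoact_pairAct N c d n a).symm).trans ?_
    have e : D.act₂Lift θ N (TensorProduct.assoc k C C N (TensorProduct.map (D.act₂ (c ⊗ₜ d))
        (rightMul k A N n) (D.coact a))) = MulOpposite.op
          (D.twistedAct D.act₂ (LinearMap.mul k A) a θ (c ⊗ₜ d)) • n := by
      rw [D.twistedAct_apply]
      generalize D.coact a = z
      induction z with
      | zero => simp
      | add x y hx hy => simp only [map_add, MulOpposite.op_add, add_smul, hx, hy]
      | tmul h b =>
        rw [TensorProduct.map_tmul, D.act₂Lift_assoc]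
        simp [mul_smul]
    refine e.trans ?_
    rw [← hθ.central]
    simp [mul_smul]
  exact LinearMap.congr_fun h x

/-- The Doi-Hopf compatibility gives `ρ(n₍₀₎ θ(c ⊗ n₍₋₁₎)) = (n₍₋₁₎ ⊗ n₍₀₎) ρ_A(θ(c ⊗ n₍₋₂₎))` after
coassociativity; the spread condition at `d = n₍₋₁₎` converts it to `∑ c₍₁₎ ⊗ n₍₀₎ θ(c₍₂₎ ⊗ n₍₋₁₎)`.
The map `U` is `d ⊗ q ⊗ n ↦ (q ⊗ n) ρ_A(θ(c ⊗ d))`. -/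
theorem IsV₃.coact_averageLinear {D : Datum k H A C} {θ : C ⊗[k] C →ₗ[k] A} (hθ : IsV₃ D θ)
    (N : DHModule D) (x : C ⊗[k] N.carrier) :
    N.coact (N.averageLinear θ x) =
      (N.averageLinear θ).lTensor C (tensorCoact k C N.carrier x) := by
  induction x with
  | zero => simp
  | add x y hx hy => simp only [map_add, hx, hy]
  | tmul c n =>
    let U : C ⊗[k] (C ⊗[k] N.carrier) →ₗ[k] C ⊗[k] N.carrier :=
      TensorProduct.lift ((D.pairAct N.carrier).flip ∘ₗ D.coact.toLinearMap ∘ₗ θ ∘ₗ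
        TensorProduct.mk k C C c)
    have h1 : ∀ y : C ⊗[k] N.carrier, N.coact (D.act₂Lift θ N.carrier (c ⊗ₜ y)) =
        U (N.coact.lTensor C y) := by
      intro y
      induction y with
      | zero => simp
      | add x y hx hy => simp only [map_add, TensorProduct.tmul_add, hx, hy]
      | tmul d n => simp [U, N.coact_smul]
    have h2 : ∀ y : C ⊗[k] N.carrier, U (TensorProduct.assoc k C C N.carrier
        ((Coalgebra.comul (R := k)).rTensor N.carrier y)) =
        (D.act₂Lift θ N.carrier).lTensor C (TensorProduct.assoc k C C (C ⊗[k] N.carrier)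
          (Coalgebra.comul (R := k) c ⊗ₜ y)) := by
      intro y
      induction y with
      | zero => simp
      | add x y hx hy => simp only [map_add, TensorProduct.tmul_add, hx, hy]
      | tmul d n =>
        have e1 : U (TensorProduct.assoc k C C N.carrier (Coalgebra.comul (R := k) d ⊗ₜ n)) =
            (rightMul k A N.carrier n).lTensor C (D.spread (θ ∘ₗ TensorProduct.mk k C C c) d) := by
          rw [Datum.spread]
          generalize Coalgebra.comul (R := k) d = z
          induction z with
          | zero => simp
          | add x y hx hy => simp only [map_add, TensorProduct.add_tmul, hx, hy]
          | tmul p q =>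
            simp only [TensorProduct.assoc_tmul, TensorProduct.lift.tmul, LinearMap.comp_apply,
              LinearMap.flip_apply, LinearMap.rTensor_tmul, Datum.swapAct, U,
              LinearMap.compl₂_apply, TensorProduct.mk_apply]
            rw [D.pairAct_lTensor]
            · simp
            · intro a b
              simp [mul_smul]
        have e2 : ∀ z : C ⊗[k] C, (rightMul k A N.carrier n).lTensor C (θ.lTensor C
            (TensorProduct.assoc k C C C (z ⊗ₜ d))) = (D.act₂Lift θ N.carrier).lTensor C
              (TensorProduct.assoc k C C (C ⊗[k] N.carrier) (z ⊗ₜ (d ⊗ₜ n))) := by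
          intro z
          induction z with
          | zero => simp
          | add x y hx hy => simp only [map_add, TensorProduct.add_tmul, hx, hy]
          | tmul p q => simp
        rw [LinearMap.rTensor_tmul, e1, ← hθ.spread, tensorCoact_tmul, e2]
    have h3 : ∀ z : C ⊗[k] C, (D.act₂Lift θ N.carrier).lTensor C
        (TensorProduct.assoc k C C (C ⊗[k] N.carrier) (z ⊗ₜ N.coact n)) =
        (N.averageLinear θ).lTensor C (TensorProduct.assoc k C C N.carrier (z ⊗ₜ n)) := by
      intro z
      induction z with
      | zero => simp
      | add x y hx hy => simp only [map_add, TensorProduct.add_tmul, hx, hy]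
      | tmul p q => simp [DHModule.averageLinear]
    rw [DHModule.averageLinear, LinearMap.comp_apply, LinearMap.lTensor_tmul, h1,
      ← N.isLeftCoaction.coassoc, h2, h3, tensorCoact_tmul]
    rfl

/-- The morphism of Doi-Hopf modules `C ⊗ N ⟶ N`, `c ⊗ n ↦ ∑ n₍₀₎ θ(c ⊗ n₍₋₁₎)`. -/
noncomputable def IsV₃.average {D : Datum k H A C} {θ : C ⊗[k] C →ₗ[k] A} (hθ : IsV₃ D θ)
    (N : DHModule D) : D.induced N.carrier ⟶ N where
  toLinearMap :=
    { toFun := N.averageLinear θ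
      map_add' := map_add _
      map_smul' := fun a x =>
        (congrArg (D.act₂Lift θ N.carrier)
          ((D.inducedMap N.coactHom.toLinearMap).toLinearMap.map_smul a x)).trans
          (hθ.act₂Lift_pairAct N.carrier _ a.unop) }
  colinear := hθ.coact_averageLinear N

theorem IsV₃.average_naturality {D : Datum k H A C} {θ : C ⊗[k] C →ₗ[k] A} (hθ : IsV₃ D θ)
    {M N : DHModule D} (f : M ⟶ N) :
    D.inducedMap f.toLinearMap ≫ hθ.average N = hθ.average M ≫ f := by
  refine DHModule.hom_ext fun (x : C ⊗[k] M.carrier) => ?_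
  change N.averageLinear θ ((f.toLinearMap.restrictScalars k).lTensor C x) =
    f.toLinearMap (M.averageLinear θ x)
  induction x with
  | zero => simp
  | add x y hx hy => simp only [map_add, hx, hy]
  | tmul c m =>
    simp only [DHModule.averageLinear, LinearMap.comp_apply, LinearMap.lTensor_tmul,
      LinearMap.restrictScalars_apply, f.colinear]
    generalize M.coact m = y
    induction y with
    | zero => simp
    | add x y hx hy => simp only [map_add, TensorProduct.tmul_add, hx, hy]
    | tmul d m => simp

theorem IsV₃.coactHom_average {D : Datum k H A C} {θ : C ⊗[k] C →ₗ[k] A} (hθ : IsV₃ D θ)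
    (h : IsNormalized₃ D θ) (M : DHModule D) : M.coactHom ≫ hθ.average M = 𝟙 M := by
  refine DHModule.hom_ext fun m => ?_
  change D.act₂Lift θ M.carrier (M.coact.lTensor C (M.coact m)) = m
  rw [← M.isLeftCoaction.coassoc]
  conv_rhs => rw [← M.counitTensor_coact m]
  generalize M.coact m = y
  induction y with
  | zero => simp
  | add x y hx hy => simp only [map_add, hx, hy]
  | tmul c m =>
    rw [LinearMap.rTensor_tmul, D.act₂Lift_assoc, h, counitTensor_tmul,
      Algebra.algebraMap_eq_smul_one, MulOpposite.op_smul, smul_assoc, MulOpposite.op_one, one_smul]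

end Induction

/-! ### Separability of the forgetful functor and integrals. -/

section Separability

variable {k H A C : Type u} [CommRing k] [Ring H] [Bialgebra k H] [Ring A] [Algebra k A]
  [AddCommGroup C] [Module k C] [Coalgebra k C] (D : Datum k H A C)

/-- Separability of the forgetful functor, in terms of linear maps. -/
theorem isSeparable_forgetCoaction_iff : IsSeparable (forgetCoaction D) ↔
    ∃ P : ∀ M N : DHModule D, (M.carrier →ₗ[Aᵐᵒᵖ] N.carrier) → (M ⟶ N),
      (∀ (M' M N N' : DHModule D) (a : M' ⟶ M) (g : M.carrier →ₗ[Aᵐᵒᵖ] N.carrier) (b : N ⟶ N'),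
        P M' N' (b.toLinearMap ∘ₗ g ∘ₗ a.toLinearMap) = a ≫ P M N g ≫ b) ∧
      ∀ (M N : DHModule D) (f : M ⟶ N), P M N f.toLinearMap = f :=
  ⟨fun ⟨P, h1, h2⟩ => ⟨fun M N g => P M N (ModuleCat.ofHom g),
    fun M' M N N' a g b => h1 M' M N N' a (ModuleCat.ofHom g) b, h2⟩,
   fun ⟨P, h1, h2⟩ => ⟨fun M N g => P M N g.hom,
    fun M' M N N' a g b => h1 M' M N N' a g.hom b, h2⟩⟩

theorem IsV₃.isSeparable {D : Datum k H A C} {θ : C ⊗[k] C →ₗ[k] A} (hθ : IsV₃ D θ)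
    (h : IsNormalized₃ D θ) : IsSeparable (forgetCoaction D) := by
  have map_comp : ∀ {M N P : DHModule D} (f : M.carrier →ₗ[Aᵐᵒᵖ] N.carrier)
      (g : N.carrier →ₗ[Aᵐᵒᵖ] P.carrier),
      D.inducedMap (g ∘ₗ f) = D.inducedMap f ≫ D.inducedMap g := fun f g =>
    DHModule.hom_ext fun x =>
      LinearMap.lTensor_comp_apply C (g.restrictScalars k) (f.restrictScalars k) x
  have coact_map : ∀ {M N : DHModule D} (f : M ⟶ N),
      M.coactHom ≫ D.inducedMap f.toLinearMap = f ≫ N.coactHom := fun f =>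
    DHModule.hom_ext fun m => (f.colinear m).symm
  rw [isSeparable_forgetCoaction_iff]
  -- An `A`-linear `g` is averaged: coact, apply `C ⊗ g`, then retract by `θ`.
  refine ⟨fun M N g => M.coactHom ≫ D.inducedMap g ≫ hθ.average N, ?_, ?_⟩
  · intro M' M N N' a g b
    beta_reduce
    rw [map_comp, map_comp, Category.assoc, Category.assoc, hθ.average_naturality,
      ← Category.assoc, coact_map]
    simp only [Category.assoc]
  · intro M N f
    beta_reduce
    rw [hθ.average_naturality, ← Category.assoc, hθ.coactHom_average h, Category.id_comp]

theorem exists_V₁_of_isSeparable (h : IsSeparable (forgetCoaction D)) :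
    ∃ ν : D.CCA ⟶ D.CA, IsV₁ D ν ∧ IsNormalized₁ D ν := by
  obtain ⟨P, hP, hP'⟩ := (isSeparable_forgetCoaction_iff D).1 h
  -- The natural left inverse, applied to the `A`-linear counits, gives a natural retraction of the
  -- coactions.
  let ν : ∀ M : DHModule D, D.induced M.carrier ⟶ M := fun M =>
    P _ _ (D.counitLinear M.carrier)
  have hν : ∀ M : DHModule D, M.coactHom ≫ ν M = 𝟙 M := by
    intro M
    have := hP _ _ _ _ M.coactHom (D.counitLinear M.carrier) (𝟙 M)
    rw [Category.comp_id] at this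
    refine this.symm.trans (Eq.trans (congrArg (P M M) ?_) (hP' M M (𝟙 M)))
    exact LinearMap.ext M.counitTensor_coact
  have nat : ∀ {M N : DHModule D} (f : M ⟶ N),
      D.inducedMap f.toLinearMap ≫ ν N = ν M ≫ f := by
    intro M N f
    have h1 := hP _ _ _ _ (D.inducedMap f.toLinearMap) (D.counitLinear N.carrier) (𝟙 N)
    have h2 := hP _ _ _ _ (𝟙 _) (D.counitLinear M.carrier) f
    rw [Category.comp_id] at h1
    rw [Category.id_comp] at h2
    rw [← h1, ← h2]
    congr 1
    exact LinearMap.ext fun x => counitTensor_lTensor (f.toLinearMap.restrictScalars k) x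
  let θ : C ⊗[k] C →ₗ[k] A := counitTensor k C A ∘ₗ D.restrict (ν D.CA)
  -- naturality along the coaction and along `A → M` expresses `ν` through `θ`
  have key : ∀ (M : DHModule D) (c : C) (m : M.carrier),
      (ν M).toLinearMap (c ⊗ₜ[k] m : C ⊗[k] M.carrier) =
        D.act₂Lift θ M.carrier (c ⊗ₜ M.coact m) := by
    intro M c m
    have h1 : (ν M).toLinearMap (c ⊗ₜ[k] m : C ⊗[k] M.carrier) =
        counitTensor k C M.carrier ((ν (D.induced M.carrier)).toLinearMap
          (c ⊗ₜ[k] M.coact m : C ⊗[k] (C ⊗[k] M.carrier))) := by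
      have := DHModule.comp_apply (nat M.coactHom) (c ⊗ₜ[k] m : C ⊗[k] M.carrier)
      exact ((congrArg (counitTensor k C M.carrier) this).trans
        (M.counitTensor_coact _)).symm
    have h2 : ∀ y : C ⊗[k] M.carrier, counitTensor k C M.carrier
        ((ν (D.induced M.carrier)).toLinearMap (c ⊗ₜ[k] y : C ⊗[k] (C ⊗[k] M.carrier))) =
        D.act₂Lift θ M.carrier (c ⊗ₜ y) := by
      let L : C ⊗[k] M.carrier →ₗ[k] M.carrier := counitTensor k C M.carrier ∘ₗ
        (ν (D.induced M.carrier)).toLinearMap.restrictScalars k ∘ₗ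
          TensorProduct.mk k C (D.induced M.carrier).carrier c
      have : L = D.act₂Lift θ M.carrier ∘ₗ TensorProduct.mk k C (C ⊗[k] M.carrier) c := by
        refine TensorProduct.ext' fun d m => ?_
        -- Naturality along `C ⊗ r`, where `r` sends `1` to `m`, moves the computation from `C ⊗ M`
        -- to `C ⊗ A`, where `θ` is defined.
        let r : A →ₗ[Aᵐᵒᵖ] M.carrier :=
          { toFun := rightMul k A M.carrier m
            map_add' := map_add _
            map_smul' := fun a b => by simp [mul_smul] }
        have e := DHModule.comp_apply (nat (D.inducedMap r))
          (c ⊗ₜ[k] (d ⊗ₜ[k] 1 : C ⊗[k] A) : C ⊗[k] (C ⊗[k] A))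
        have e' : (r.restrictScalars k).lTensor C (d ⊗ₜ[k] (1 : A)) = d ⊗ₜ m := by
          change d ⊗ₜ[k] (MulOpposite.op (1 : A) • m) = _
          rw [MulOpposite.op_one, one_smul]
        have e1 : (D.inducedMap (D.inducedMap r).toLinearMap).toLinearMap
          (c ⊗ₜ[k] (d ⊗ₜ[k] 1 : C ⊗[k] A) : C ⊗[k] (C ⊗[k] A)) =
          (c ⊗ₜ[k] (d ⊗ₜ[k] m : C ⊗[k] M.carrier) : C ⊗[k] (C ⊗[k] M.carrier)) :=
          congrArg (fun z => (c ⊗ₜ[k] z : C ⊗[k] (C ⊗[k] M.carrier))) e'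
        refine ((congrArg (fun z => counitTensor k C M.carrier
          ((ν (D.induced M.carrier)).toLinearMap z)) e1.symm).trans
          (congrArg (counitTensor k C M.carrier) e)).trans ?_
        exact counitTensor_lTensor (r.restrictScalars k) _
      exact fun y => LinearMap.congr_fun this y
    rw [h1, h2]
  refine ⟨ν D.CA, ⟨fun a b c d => ?_, fun c d => ?_⟩, fun c a => ?_⟩
  · let f : A →ₗ[Aᵐᵒᵖ] A :=
      { toFun := LinearMap.mul k A b
        map_add' := map_add _
        map_smul' := fun a b => by simp [mul_assoc] }
    exact DHModule.comp_apply (nat (D.inducedMap f))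
      (c ⊗ₜ[k] (d ⊗ₜ[k] a : C ⊗[k] A) : C ⊗[k] (C ⊗[k] A))
  -- The spread condition is the formula for `ν` at the element `d ⊗ 1`, whose coaction is `∑ d₍₁₎ ⊗
  -- d₍₂₎ ⊗ 1`.
  · refine Eq.trans ?_ (key D.CA c (d ⊗ₜ[k] 1 : C ⊗[k] A)).symm
    rw [D.spreadCA_eq_spread, Datum.spread]
    have e : D.CA.coact (d ⊗ₜ[k] 1 : C ⊗[k] A) =
      TensorProduct.assoc k C C A (Coalgebra.comul (R := k) d ⊗ₜ 1) := rfl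
    rw [e]
    generalize Coalgebra.comul (R := k) d = z
    let L : C ⊗[k] C →ₗ[k] C ⊗[k] A := D.act₂Lift θ D.CA.carrier ∘ₗ
      TensorProduct.mk k C (C ⊗[k] D.CA.carrier) c ∘ₗ
        (TensorProduct.assoc k C C A).toLinearMap ∘ₗ (TensorProduct.mk k (C ⊗[k] C) A).flip 1
    have hL : D.swapAct ∘ₗ (D.coact.toLinearMap ∘ₗ θ ∘ₗ TensorProduct.mk k C C c).rTensor C = L :=
      TensorProduct.ext' fun p q => rfl
    exact LinearMap.congr_fun hL z
  · exact DHModule.comp_apply (hν D.CA) (c ⊗ₜ[k] a : C ⊗[k] A)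

end Separability

/-! ### Flatness and Doi-Hopf submodules. -/

theorem lTensor_mkQ_eq_zero {k A C : Type u} [CommRing k] [Ring A]
    [Algebra k A] [AddCommGroup C] [Module k C] [Module.Flat k C] {M Y : Type u} [AddCommGroup M]
    [Module k M] [Module Aᵐᵒᵖ M] [IsScalarTower k Aᵐᵒᵖ M] [AddCommGroup Y] [Module k Y] [Module Aᵐᵒᵖ Y]
    [IsScalarTower k Aᵐᵒᵖ Y] (f : M →ₗ[Aᵐᵒᵖ] Y) {N : Submodule Aᵐᵒᵖ M}
    (hN : LinearMap.ker f ≤ N) {t : C ⊗[k] M} (ht : (f.restrictScalars k).lTensor C t = 0) :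
    (N.mkQ.restrictScalars k).lTensor C t = 0 := by
  -- By flatness `C ⊗ M/ker f → C ⊗ Y` is injective, so `t` already dies in `C ⊗ M/ker f`.
  let q : (M ⧸ LinearMap.ker f) →ₗ[Aᵐᵒᵖ] Y := (LinearMap.ker f).liftQ f le_rfl
  have hq : Function.Injective q :=
    LinearMap.ker_eq_bot.1 (Submodule.ker_liftQ_eq_bot _ f le_rfl le_rfl)
  have e1 : f.restrictScalars k = q.restrictScalars k ∘ₗ (LinearMap.ker f).mkQ.restrictScalars k :=
    rfl
  have e2 : N.mkQ.restrictScalars k =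
    (Submodule.factor hN).restrictScalars k ∘ₗ (LinearMap.ker f).mkQ.restrictScalars k := rfl
  rw [e1, LinearMap.lTensor_comp_apply] at ht
  have h := Module.Flat.lTensor_preserves_injective_linearMap (M := C) (q.restrictScalars k) hq
    (ht.trans (map_zero _).symm)
  rw [e2, LinearMap.lTensor_comp_apply, h, map_zero]

section Subcomodules

variable {k H A C : Type u} [CommRing k] [Ring H] [Bialgebra k H] [Ring A] [Algebra k A]
  [AddCommGroup C] [Module k C] [Coalgebra k C] {D : Datum k H A C}

/-- The morphism `M ⟶ C ⊗ M/N` whose kernel is the largest Doi-Hopf submodule of `N`. -/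
noncomputable def DHModule.toInducedQuotient (M : DHModule D) (N : Submodule Aᵐᵒᵖ M.carrier) :
    M ⟶ D.induced (M.carrier ⧸ N) :=
  M.coactHom ≫ D.inducedMap N.mkQ

/-- The largest Doi-Hopf submodule contained in an `A`-submodule. -/
noncomputable def DHModule.interior (M : DHModule D) (N : Submodule Aᵐᵒᵖ M.carrier) :
    Submodule Aᵐᵒᵖ M.carrier :=
  LinearMap.ker (M.toInducedQuotient N).toLinearMap

theorem DHModule.mem_interior {M : DHModule D} {N : Submodule Aᵐᵒᵖ M.carrier} {m : M.carrier} :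
    m ∈ M.interior N ↔ (N.mkQ.restrictScalars k).lTensor C (M.coact m) = 0 := Iff.rfl

theorem DHModule.interior_le (M : DHModule D) (N : Submodule Aᵐᵒᵖ M.carrier) :
    M.interior N ≤ N := fun m hm => by
  have h := congrArg (counitTensor k C _) (DHModule.mem_interior.1 hm)
  rw [counitTensor_lTensor, M.counitTensor_coact, map_zero] at h
  exact (Submodule.Quotient.mk_eq_zero N).1 h

theorem DHModule.interior_mono (M : DHModule D) {N N' : Submodule Aᵐᵒᵖ M.carrier} (h : N ≤ N') :
    M.interior N ≤ M.interior N' := fun m hm => by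
  rw [DHModule.mem_interior] at hm ⊢
  have e : N'.mkQ.restrictScalars k =
    (Submodule.factor h).restrictScalars k ∘ₗ N.mkQ.restrictScalars k := rfl
  rw [e, LinearMap.lTensor_comp_apply, hm, map_zero]

/-- The condition `N ≤ M.interior N` is how an `A`-submodule is said to be a Doi-Hopf submodule.
Kernels satisfy it by flatness, ranges by a direct computation. -/
theorem DHModule.ker_le_interior {M N : DHModule D} (f : M ⟶ N) :
    LinearMap.ker f.toLinearMap ≤ M.interior (LinearMap.ker f.toLinearMap) := fun m hm => by
  have := D.flat
  refine DHModule.mem_interior.2 (lTensor_mkQ_eq_zero f.toLinearMap le_rfl ?_)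
  rw [← f.colinear, LinearMap.mem_ker.1 hm, map_zero]

theorem DHModule.range_le_interior {M N : DHModule D} (f : M ⟶ N) :
    LinearMap.range f.toLinearMap ≤ N.interior (LinearMap.range f.toLinearMap) := by
  rintro _ ⟨m, rfl⟩
  rw [DHModule.mem_interior, f.colinear, ← LinearMap.lTensor_comp_apply]
  have e : (LinearMap.range f.toLinearMap).mkQ.restrictScalars k ∘ₗ
      f.toLinearMap.restrictScalars k = 0 := LinearMap.ext fun m =>
    (Submodule.Quotient.mk_eq_zero _).2 ⟨m, rfl⟩
  rw [e, LinearMap.lTensor_zero, LinearMap.zero_apply]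

theorem DHModule.le_interior_interior (M : DHModule D) (N : Submodule Aᵐᵒᵖ M.carrier) :
    M.interior N ≤ M.interior (M.interior N) :=
  DHModule.ker_le_interior (M.toInducedQuotient N)

/-- `N ⊓ N'` is the kernel of `M → M/N × M/N'`, to which flatness applies. -/
theorem DHModule.inf_le_interior {M : DHModule D} {N N' : Submodule Aᵐᵒᵖ M.carrier}
    (hN : N ≤ M.interior N) (hN' : N' ≤ M.interior N') : N ⊓ N' ≤ M.interior (N ⊓ N') := by
  rintro m ⟨hm, hm'⟩
  have := D.flat
  refine DHModule.mem_interior.2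
    (lTensor_mkQ_eq_zero (N.mkQ.prod N'.mkQ) (by simp [LinearMap.ker_prod]) ?_)
  have e : (N.mkQ.prod N'.mkQ).restrictScalars k =
      LinearMap.inl k (M.carrier ⧸ N) (M.carrier ⧸ N') ∘ₗ N.mkQ.restrictScalars k +
      LinearMap.inr k (M.carrier ⧸ N) (M.carrier ⧸ N') ∘ₗ N'.mkQ.restrictScalars k := by
    ext m <;> simp
  rw [e, LinearMap.lTensor_add, LinearMap.add_apply, LinearMap.lTensor_comp_apply,
    LinearMap.lTensor_comp_apply, DHModule.mem_interior.1 (hN hm),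
    DHModule.mem_interior.1 (hN' hm')]
  simp

section Sub

variable (M : DHModule D) (N : Submodule Aᵐᵒᵖ M.carrier)

theorem DHModule.lTensor_subtype_injective :
    Function.Injective ((N.subtype.restrictScalars k).lTensor C) :=
  have := D.flat
  Module.Flat.lTensor_preserves_injective_linearMap _ N.subtype_injective

theorem DHModule.mem_range_lTensor_subtype {t : C ⊗[k] M.carrier}
    (ht : (N.mkQ.restrictScalars k).lTensor C t = 0) :
    t ∈ LinearMap.range ((N.subtype.restrictScalars k).lTensor C) := by
  have hex : Function.Exact (N.subtype.restrictScalars k) (N.mkQ.restrictScalars k) :=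
    LinearMap.exact_subtype_mkQ N
  exact (lTensor_exact C hex N.mkQ_surjective t).1 ht

variable {N} (hN : N ≤ M.interior N)

/-- The coaction on a Doi-Hopf submodule. -/
noncomputable def DHModule.subCoact : N →ₗ[k] C ⊗[k] N :=
  (LinearEquiv.ofInjective _ (M.lTensor_subtype_injective N)).symm.toLinearMap ∘ₗ
    LinearMap.codRestrict _ (M.coact ∘ₗ N.subtype.restrictScalars k) fun n =>
      M.mem_range_lTensor_subtype N (hN n.2)

theorem DHModule.lTensor_subtype_subCoact (n : N) :
    (N.subtype.restrictScalars k).lTensor C (M.subCoact hN n) = M.coact n :=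
  congrArg Subtype.val ((LinearEquiv.ofInjective _ (M.lTensor_subtype_injective N)).apply_symm_apply
    ⟨M.coact n, M.mem_range_lTensor_subtype N (hN n.2)⟩)

/-- A submodule `N` with `ρ(N) ⊆ C ⊗ N`, as a Doi-Hopf module. -/
noncomputable def DHModule.sub : DHModule D where
  carrier := N
  coact := M.subCoact hN
  isLeftCoaction :=
    { coassoc := fun n => by
        -- Flatness, used twice, makes `C ⊗ C ⊗ N → C ⊗ C ⊗ M` injective, so coassociativity is
        -- inherited from `M`.
        have := D.flat
        apply Module.Flat.lTensor_preserves_injective_linearMap (M := C) _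
          (M.lTensor_subtype_injective N)
        have h1 : ∀ t : C ⊗[k] N, ((N.subtype.restrictScalars k).lTensor C).lTensor C
            (TensorProduct.assoc k C C N ((Coalgebra.comul (R := k)).rTensor N t)) =
            TensorProduct.assoc k C C M.carrier ((Coalgebra.comul (R := k)).rTensor M.carrier
              ((N.subtype.restrictScalars k).lTensor C t)) := fun t =>
          (tensorCoact_lTensor (N.subtype.restrictScalars k) t).symm
        have h2 : (N.subtype.restrictScalars k).lTensor C ∘ₗ M.subCoact hN =
            M.coact ∘ₗ N.subtype.restrictScalars k :=
          LinearMap.ext (M.lTensor_subtype_subCoact hN)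
        rw [h1, M.lTensor_subtype_subCoact, M.isLeftCoaction.coassoc,
          ← LinearMap.lTensor_comp_apply, h2, LinearMap.lTensor_comp_apply,
          M.lTensor_subtype_subCoact]
      counit := fun n => by
        apply N.subtype_injective
        have h := counitTensor_lTensor (N.subtype.restrictScalars k) (M.subCoact hN n)
        rw [M.lTensor_subtype_subCoact, M.counitTensor_coact] at h
        exact h.symm }
  coact_smul n a := by
    apply M.lTensor_subtype_injective N
    rw [M.lTensor_subtype_subCoact, D.pairAct_lTensor _ (fun a n => rfl),
      M.lTensor_subtype_subCoact]
    exact M.coact_smul n a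

/-- The inclusion of a Doi-Hopf submodule. -/
noncomputable def DHModule.subι : M.sub hN ⟶ M where
  toLinearMap := N.subtype
  colinear n := (M.lTensor_subtype_subCoact hN n).symm

theorem DHModule.subι_injective : Function.Injective (M.subι hN).toLinearMap :=
  N.subtype_injective

theorem DHModule.range_subι : LinearMap.range (M.subι hN).toLinearMap = N := N.range_subtype

end Sub

/-- The kernel is a Doi-Hopf submodule, and its inclusion is killed by `f`, hence zero. -/
theorem DHModule.injective_of_mono {M N : DHModule D} (f : M ⟶ N) [Mono f] :
    Function.Injective f.toLinearMap := by
  have hK := DHModule.ker_le_interior f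
  have h : M.subι hK = 0 := by
    rw [← cancel_mono f, zero_comp]
    exact DHModule.hom_ext fun n => n.2
  rw [← LinearMap.ker_eq_bot, ← M.range_subι hK, h]
  exact LinearMap.range_zero

/-- The morphism `N ⟶ C ⊗ N/range f` vanishes after `f`, hence is zero; its kernel lies in the
range. -/
theorem DHModule.surjective_of_epi {M N : DHModule D} (f : M ⟶ N) [Epi f] :
    Function.Surjective f.toLinearMap := by
  have h : N.toInducedQuotient (LinearMap.range f.toLinearMap) = 0 := by
    rw [← cancel_epi f, comp_zero]
    exact DHModule.hom_ext fun m => DHModule.range_le_interior f ⟨m, rfl⟩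
  rw [← LinearMap.range_eq_top, eq_top_iff]
  refine le_trans (fun n _ => ?_) (N.interior_le _)
  rw [DHModule.interior, h]
  exact LinearMap.mem_ker.2 rfl

theorem DHModule.isIso_of_bijective {M N : DHModule D} (f : M ⟶ N)
    (hf : Function.Bijective f.toLinearMap) : IsIso f := by
  let e := LinearEquiv.ofBijective f.toLinearMap hf
  let g : N ⟶ M :=
    { toLinearMap := e.symm.toLinearMap
      colinear := fun n => by
        obtain ⟨m, rfl⟩ := hf.2 n
        have h : e.symm.toLinearMap.restrictScalars k ∘ₗ f.toLinearMap.restrictScalars k =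
          LinearMap.id := LinearMap.ext e.symm_apply_apply
        rw [f.colinear, ← LinearMap.lTensor_comp_apply, h, LinearMap.lTensor_id_apply]
        exact congrArg M.coact (e.symm_apply_apply m) }
  exact ⟨g, DHModule.hom_ext e.symm_apply_apply, DHModule.hom_ext e.apply_symm_apply⟩

end Subcomodules

/-! ### The lattice of Doi-Hopf submodules. -/

section Lattice

variable {k H A C : Type u} [CommRing k] [Ring H] [Bialgebra k H] [Ring A] [Algebra k A]
  [AddCommGroup C] [Module k C] [Coalgebra k C] {D : Datum k H A C}

/-- The Doi-Hopf submodules of a Doi-Hopf module. -/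
@[ext]
structure DHModule.Sub (M : DHModule D) : Type u where
  val : Submodule Aᵐᵒᵖ M.carrier
  le_interior : val ≤ M.interior val

instance (M : DHModule D) : PartialOrder M.Sub :=
  PartialOrder.lift DHModule.Sub.val fun _ _ => DHModule.Sub.ext

/-- The inclusion of Doi-Hopf submodules into `A`-submodules is left adjoint to the interior. -/
noncomputable def DHModule.interiorCoinsertion (M : DHModule D) :
    GaloisCoinsertion (fun N : M.Sub => N.1)
      (fun N => (⟨M.interior N, M.le_interior_interior N⟩ : M.Sub)) where
  choice N _ := ⟨M.interior N, M.le_interior_interior N⟩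
  gc N N' := ⟨fun h => N.2.trans (M.interior_mono h), fun h => le_trans h (M.interior_le N')⟩
  u_l_le N := M.interior_le N.1
  choice_eq _ _ := rfl

noncomputable instance (M : DHModule D) : CompleteLattice M.Sub :=
  M.interiorCoinsertion.liftCompleteLattice

namespace DHModule.Sub

variable {M : DHModule D}

theorem val_sup (a b : M.Sub) : (a ⊔ b).1 = a.1 ⊔ b.1 := M.interiorCoinsertion.gc.l_sup

theorem val_iSup {ι : Sort*} (a : ι → M.Sub) : (⨆ i, a i).1 = ⨆ i, (a i).1 :=
  M.interiorCoinsertion.gc.l_iSup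

theorem val_bot : (⊥ : M.Sub).1 = ⊥ := M.interiorCoinsertion.gc.l_bot

theorem val_top : (⊤ : M.Sub).1 = ⊤ := by
  have h : (⊤ : Submodule Aᵐᵒᵖ M.carrier) ≤ M.interior ⊤ := by
    have := DHModule.range_le_interior (𝟙 M)
    rwa [DHModule.id_toLinearMap, LinearMap.range_id] at this
  exact top_le_iff.1 (show (⟨⊤, h⟩ : M.Sub) ≤ ⊤ from le_top : ⊤ ≤ (⊤ : M.Sub).1)

theorem val_inf (a b : M.Sub) : (a ⊓ b).1 = a.1 ⊓ b.1 := by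
  refine le_antisymm (le_inf (show a ⊓ b ≤ a from inf_le_left) (show a ⊓ b ≤ b from inf_le_right))
    ?_
  let c : M.Sub := ⟨a.1 ⊓ b.1, DHModule.inf_le_interior a.2 b.2⟩
  have h : c ≤ a ⊓ b := le_inf (show c.1 ≤ a.1 from inf_le_left) (show c.1 ≤ b.1 from inf_le_right)
  exact h

theorem le_def {a b : M.Sub} : a ≤ b ↔ a.1 ≤ b.1 := Iff.rfl

instance : IsModularLattice M.Sub where
  sup_inf_le_assoc_of_le {x} y {z} h := by
    rw [le_def, val_sup, val_inf, val_sup, val_inf]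
    exact sup_inf_le_assoc_of_le y.1 h

theorem disjoint_iff_val {a b : M.Sub} : Disjoint a b ↔ Disjoint a.1 b.1 := by
  rw [disjoint_iff, disjoint_iff, ← val_inf, ← val_bot]
  exact Sub.ext_iff

theorem codisjoint_iff_val {a b : M.Sub} : Codisjoint a b ↔ Codisjoint a.1 b.1 := by
  rw [codisjoint_iff, codisjoint_iff, ← val_sup, ← val_top]
  exact Sub.ext_iff

/-- Suprema agree with those of `A`-submodules, where finitely generated means compact. -/
theorem isCompactElement_of_fg {a : M.Sub} (ha : a.1.FG) : IsCompactElement a := by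
  rw [CompleteLattice.isCompactElement_iff_le_of_directed_sSup_le]
  intro s hs hd hle
  have hc := (Submodule.fg_iff_compact _).1 ha
  rw [CompleteLattice.isCompactElement_iff_le_of_directed_sSup_le] at hc
  obtain ⟨_, ⟨b, hb, rfl⟩, hab⟩ := hc (Sub.val '' s) (hs.image _)
    (by
      rintro _ ⟨x, hx, rfl⟩ _ ⟨y, hy, rfl⟩
      obtain ⟨z, hz, hxz, hyz⟩ := hd x hx y hy
      exact ⟨_, ⟨z, hz, rfl⟩, hxz, hyz⟩)
    (by
      have h : (sSup s).1 = ⨆ b ∈ s, b.1 := M.interiorCoinsertion.gc.l_sSup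
      rw [sSup_image, ← h]
      exact hle)
  exact ⟨b, hb, hab⟩

/-- A tensor involves finitely many elements of `N`; `F` is generated by them. -/
theorem exists_fg_lTensor_mkQ_eq_zero (N : Submodule Aᵐᵒᵖ M.carrier) (t : C ⊗[k] N) :
    ∃ F : Submodule Aᵐᵒᵖ M.carrier, F.FG ∧ F ≤ N ∧
      (F.mkQ.restrictScalars k).lTensor C ((N.subtype.restrictScalars k).lTensor C t) = 0 := by
  induction t with
  | zero => exact ⟨⊥, Submodule.fg_bot, bot_le, by simp⟩
  | tmul c n =>
    refine ⟨Submodule.span _ {(n : M.carrier)}, Submodule.fg_span_singleton _, by simp, ?_⟩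
    have h : (Submodule.span Aᵐᵒᵖ {(n : M.carrier)}).mkQ n = 0 :=
      (Submodule.Quotient.mk_eq_zero _).2 (Submodule.mem_span_singleton_self _)
    simp only [LinearMap.lTensor_tmul, LinearMap.restrictScalars_apply, Submodule.subtype_apply, h,
      TensorProduct.tmul_zero]
  | add x y hx hy =>
    obtain ⟨F, hF, hFN, hx⟩ := hx
    obtain ⟨G, hG, hGN, hy⟩ := hy
    refine ⟨F ⊔ G, hF.sup hG, sup_le hFN hGN, ?_⟩
    have e1 : (F ⊔ G).mkQ.restrictScalars k = (Submodule.factor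
      (le_sup_left : F ≤ F ⊔ G)).restrictScalars k ∘ₗ F.mkQ.restrictScalars k := rfl
    have e2 : (F ⊔ G).mkQ.restrictScalars k = (Submodule.factor
      (le_sup_right : G ≤ F ⊔ G)).restrictScalars k ∘ₗ G.mkQ.restrictScalars k := rfl
    rw [map_add, map_add]
    nth_rw 1 [e1]
    rw [e2, LinearMap.lTensor_comp_apply, LinearMap.lTensor_comp_apply, hx, hy, map_zero, map_zero,
      add_zero]

/-- Every element of a Doi-Hopf submodule lies in a Doi-Hopf submodule of it which is contained in
a finitely generated `A`-module. -/
theorem exists_mem_interior (a : M.Sub) {m : M.carrier} (hm : m ∈ a.1) :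
    ∃ F : Submodule Aᵐᵒᵖ M.carrier, F.FG ∧ F ≤ a.1 ∧ m ∈ M.interior F := by
  obtain ⟨F, hF, hFa, h⟩ := exists_fg_lTensor_mkQ_eq_zero a.1 (M.subCoact a.2 ⟨m, hm⟩)
  rw [M.lTensor_subtype_subCoact] at h
  exact ⟨F, hF, hFa, h⟩

/-- A finitely generated semisimple module is noetherian, so the interior of a finitely generated
`F` is finitely generated, hence compact; such interiors exhaust `a`. -/
instance [IsSemisimpleModule Aᵐᵒᵖ M.carrier] : IsCompactlyGenerated M.Sub where
  exists_sSup_eq a := by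
    refine ⟨{b | IsCompactElement b ∧ b ≤ a}, fun b hb => hb.1,
      le_antisymm (sSup_le fun b hb => hb.2) fun m hm => ?_⟩
    obtain ⟨F, hF, hFa, h⟩ := exists_mem_interior a hm
    have hfg : (M.interior F).FG := by
      have : Module.Finite Aᵐᵒᵖ F := Module.Finite.iff_fg.2 hF
      have : (M.interior F) = ((M.interior F).comap F.subtype).map F.subtype := by
        rw [Submodule.map_comap_subtype]
        exact (inf_eq_right.2 (M.interior_le F)).symm
      rw [this]
      exact (IsNoetherian.noetherian _).map _
    let b : M.Sub := ⟨M.interior F, M.le_interior_interior F⟩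
    have hb : b ≤ sSup {b | IsCompactElement b ∧ b ≤ a} :=
      le_sSup ⟨isCompactElement_of_fg hfg, (M.interior_le F).trans hFa⟩
    exact hb h

theorem simple_of_isAtom {a : M.Sub} (ha : IsAtom a) : Simple (M.sub a.2) where
  mono_isIso_iff_nonzero {Y} f _ := by
    constructor
    · rintro hf rfl
      have h : 𝟙 (M.sub a.2) = 0 := by
        rw [← IsIso.inv_hom_id (0 : Y ⟶ M.sub a.2), comp_zero]
      refine ha.1 (Sub.ext ?_)
      rw [val_bot, eq_bot_iff]
      intro m hm
      have := DHModule.comp_apply (f := 𝟙 (M.sub a.2)) (g := M.subι a.2) (h := 0)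
        (by rw [h, zero_comp]) (⟨m, hm⟩ : a.1)
      exact this
    · intro hf
      -- The image of `f` in `M` lies below the atom: it is zero, so `f = 0`, or all of `a`, so the
      -- monomorphism `f` is bijective.
      let b : M.Sub := ⟨LinearMap.range (f ≫ M.subι a.2).toLinearMap,
        DHModule.range_le_interior (f ≫ M.subι a.2)⟩
      have hb : b ≤ a := by
        rintro _ ⟨y, rfl⟩
        exact (f.toLinearMap y).2
      rcases ha.le_iff.1 hb with h | h
      · refine absurd (DHModule.hom_ext fun y => M.subι_injective a.2 ?_) hf
        have h0 : (f ≫ M.subι a.2).toLinearMap y ∈ b.1 := ⟨y, rfl⟩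
        rw [h, val_bot, Submodule.mem_bot] at h0
        exact h0
      · refine DHModule.isIso_of_bijective f ⟨DHModule.injective_of_mono f, fun n => ?_⟩
        have hn : (M.subι a.2).toLinearMap n ∈ b.1 := by
          rw [h]
          exact Subtype.property (p := (· ∈ a.1)) n
        obtain ⟨y, hy⟩ := hn
        exact ⟨y, M.subι_injective a.2 hy⟩

/-- An internal direct sum decomposition into Doi-Hopf submodules is a coproduct. -/
theorem isColimit_of_iSupIndep {ι : Type u} (a : ι → M.Sub) (hi : iSupIndep a)
    (ht : ⨆ j, a j = ⊤) : Nonempty (IsColimit (Cofan.mk M fun j => M.subι (a j).2)) := by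
  classical
  have hi' : iSupIndep fun j => (a j).1 := fun j => by
    have := disjoint_iff_val.1 (hi j)
    simpa only [val_iSup] using this
  have ht' : ⨆ j, (a j).1 = ⊤ := by rw [← val_iSup, ht, val_top]
  have hint := DirectSum.isInternal_submodule_of_iSupIndep_of_iSup_eq_top hi' ht'
  let e := LinearEquiv.ofBijective (DirectSum.coeLinearMap fun j => (a j).1) hint
  -- Stated for additive maps to serve both the `k`-linear maps in the colinearity check and the
  -- `A`-linear maps in the uniqueness check.
  have ext : ∀ {T : Type u} [AddCommGroup T] {f g : M.carrier →+ T},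
      (∀ j, ∀ m ∈ (a j).1, f m = g m) → f = g := by
    intro T _ f g h
    refine AddMonoidHom.ext fun m => ?_
    have hm : m ∈ ⨆ j, (a j).1 := ht' ▸ Submodule.mem_top
    induction hm using Submodule.iSup_induction' with
    | mem j m hm => exact h j m hm
    | zero => simp
    | add x y _ _ hx hy => rw [map_add, map_add, hx, hy]
  let desc : ∀ t : Cofan fun j => M.sub (a j).2, M.carrier →ₗ[Aᵐᵒᵖ] t.pt.carrier := fun t =>
    DirectSum.toModule Aᵐᵒᵖ ι t.pt.carrier (fun j => (t.inj j).toLinearMap) ∘ₗ e.symm.toLinearMap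
  have hdesc : ∀ (t : Cofan fun j => M.sub (a j).2) (j : ι) (m : (a j).1),
      desc t m = (t.inj j).toLinearMap m := by
    intro t j m
    have h : e.symm m = DirectSum.lof Aᵐᵒᵖ ι (fun j => (a j).1) j m := by
      rw [LinearEquiv.symm_apply_eq]
      exact (DirectSum.coeLinearMap_lof (fun j => (a j).1) j m).symm
    change DirectSum.toModule Aᵐᵒᵖ ι t.pt.carrier (fun j => (t.inj j).toLinearMap) (e.symm m) = _
    rw [h]
    exact DirectSum.toModule_lof _ _ _
  refine ⟨Cofan.IsColimit.mk _ (fun t => ⟨desc t, fun m => ?_⟩) (fun t j => ?_) fun t f hf => ?_⟩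
  · refine DFunLike.congr_fun (ext (f := (t.pt.coact ∘ₗ (desc t).restrictScalars k).toAddMonoidHom)
      (g := (((desc t).restrictScalars k).lTensor C ∘ₗ M.coact).toAddMonoidHom) ?_) m
    intro j m hm
    have h1 : (desc t).restrictScalars k ∘ₗ (a j).1.subtype.restrictScalars k =
      (t.inj j).toLinearMap.restrictScalars k := LinearMap.ext (hdesc t j)
    change t.pt.coact (desc t (⟨m, hm⟩ : (a j).1)) =
      ((desc t).restrictScalars k).lTensor C (M.coact (⟨m, hm⟩ : (a j).1))
    refine ((congrArg t.pt.coact (hdesc t j ⟨m, hm⟩)).trans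
      ((t.inj j).colinear (⟨m, hm⟩ : (a j).1))).trans ?_
    rw [← M.lTensor_subtype_subCoact (a j).2, ← LinearMap.lTensor_comp_apply, h1]
    rfl
  · exact DHModule.hom_ext (hdesc t j)
  · refine DHModule.hom_ext fun m => ?_
    refine DFunLike.congr_fun (ext (f := f.toLinearMap.toAddMonoidHom)
      (g := (desc t).toAddMonoidHom) fun j m hm => ?_) m
    exact (DHModule.comp_apply (hf j) (⟨m, hm⟩ : (a j).1)).trans (hdesc t j ⟨m, hm⟩).symm

end DHModule.Sub

end Lattice

/-! ### Consequences of separability. -/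

section Consequences

variable {k H A C : Type u} [CommRing k] [Ring H] [Bialgebra k H] [Ring A] [Algebra k A]
  [AddCommGroup C] [Module k C] [Coalgebra k C] {D : Datum k H A C}

/-- For a retraction `r` of `F f`, naturality gives `f ≫ P r = P (F f ≫ r) = P (F 𝟙) = 𝟙`. -/
theorem IsSeparable.isSplitMono {𝒞 𝒟 : Type*} [Category 𝒞] [Category 𝒟] {F : 𝒞 ⥤ 𝒟}
    (hF : IsSeparable F) {M N : 𝒞} (f : M ⟶ N) (hf : IsSplitMono (F.map f)) : IsSplitMono f := by
  obtain ⟨P, h1, h2⟩ := hF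
  refine ⟨⟨⟨P _ _ (retraction (F.map f)), ?_⟩⟩⟩
  have := h1 _ _ _ _ f (retraction (F.map f)) (𝟙 M)
  rw [Category.comp_id] at this
  rw [← this, F.map_id, Category.comp_id, IsSplitMono.id, ← F.map_id, h2]

theorem IsSeparable.isSplitEpi {𝒞 𝒟 : Type*} [Category 𝒞] [Category 𝒟] {F : 𝒞 ⥤ 𝒟}
    (hF : IsSeparable F) {M N : 𝒞} (f : M ⟶ N) (hf : IsSplitEpi (F.map f)) : IsSplitEpi f := by
  obtain ⟨P, h1, h2⟩ := hF
  refine ⟨⟨⟨P _ _ (section_ (F.map f)), ?_⟩⟩⟩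
  have := h1 _ _ _ _ (𝟙 N) (section_ (F.map f)) f
  rw [Category.id_comp] at this
  rw [← this, F.map_id, Category.id_comp, IsSplitEpi.id, ← F.map_id, h2]

theorem IsSeparable.projective (hF : IsSeparable (forgetCoaction D)) (M : DHModule D)
    [Module.Projective Aᵐᵒᵖ M.carrier] : Projective M where
  factors {X Y} f e _ := by
    obtain ⟨P, h1, h2⟩ := (isSeparable_forgetCoaction_iff D).1 hF
    obtain ⟨g, hg⟩ := Module.projective_lifting_property e.toLinearMap f.toLinearMap
      (DHModule.surjective_of_epi e)
    refine ⟨P _ _ g, ?_⟩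
    have := h1 _ _ _ _ (𝟙 M) g e
    rw [Category.id_comp] at this
    rw [← this, ← h2 _ _ f, ← hg]
    rfl

theorem IsSeparable.injective (hF : IsSeparable (forgetCoaction D)) (M : DHModule D)
    [hM : Module.Injective Aᵐᵒᵖ M.carrier] : Injective M where
  factors {X Y} f i _ := by
    obtain ⟨P, h1, h2⟩ := (isSeparable_forgetCoaction_iff D).1 hF
    obtain ⟨g, hg⟩ := hM.out i.toLinearMap (DHModule.injective_of_mono i) f.toLinearMap
    refine ⟨P _ _ g, ?_⟩
    have := h1 _ _ _ _ i g (𝟙 M)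
    rw [Category.comp_id] at this
    rw [← this, ← h2 _ _ f]
    exact congrArg (P X M) (LinearMap.ext hg)

theorem IsSeparable.complementedLattice (hF : IsSeparable (forgetCoaction D)) (M : DHModule D)
    [IsSemisimpleModule Aᵐᵒᵖ M.carrier] : ComplementedLattice M.Sub where
  exists_isCompl a := by
    obtain ⟨N, hN⟩ := exists_isCompl a.1
    obtain ⟨P, h1, h2⟩ := (isSeparable_forgetCoaction_iff D).1 hF
    -- The `A`-complement `N` need not be a subcomodule; the kernel of the Doi-Hopf retraction `P r`
    -- replaces it.
    let r : M.carrier →ₗ[Aᵐᵒᵖ] (M.sub a.2).carrier := a.1.projectionOnto N hN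
    have h : M.subι a.2 ≫ P _ _ r = 𝟙 _ := by
      have := h1 _ _ _ _ (M.subι a.2) r (𝟙 _)
      rw [Category.comp_id] at this
      refine this.symm.trans (Eq.trans (congrArg (P _ _) ?_) (h2 _ _ (𝟙 (M.sub a.2))))
      exact LinearMap.ext fun n => Submodule.projectionOnto_apply_left hN n
    have hc := LinearMap.isCompl_of_proj (f := (P _ _ r).toLinearMap) (p := a.1)
      (fun n => DHModule.comp_apply h n)
    exact ⟨⟨_, DHModule.ker_le_interior (P _ _ r)⟩,
      DHModule.Sub.disjoint_iff_val.2 hc.1, DHModule.Sub.codisjoint_iff_val.2 hc.2⟩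

theorem IsSeparable.isSemisimpleObject (hF : IsSeparable (forgetCoaction D)) (M : DHModule D)
    [IsSemisimpleModule Aᵐᵒᵖ M.carrier] : IsSemisimpleObject M := by
  have := hF.complementedLattice M
  obtain ⟨s, hs, htop, hatom⟩ :=
    exists_sSupIndep_of_sSup_atoms_eq_top (sSup_atoms_eq_top (α := M.Sub))
  refine ⟨s, fun a => M.sub a.1.2, fun a => M.subι a.1.2,
    fun a => DHModule.Sub.simple_of_isAtom (hatom a.2),
    DHModule.Sub.isColimit_of_iSupIndep (fun a : s => a.1) ((sSupIndep_iff _).1 hs) ?_⟩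
  rw [← sSup_eq_iSup', htop]

end Consequences

end DoiHopf

theorem theorem2p1p5 {k H A C : Type u} [CommRing k] [Ring H] [Bialgebra k H] [Ring A]
    [Algebra k A] [AddCommGroup C] [Module k C] [Coalgebra k C] (D : DoiHopf.Datum k H A C) :
    -- the equivalent forms of the existence of a total integral
    List.TFAE [
      ∃ γ : C →ₗ[k] C →ₗ[k] A, DoiHopf.IsTotalIntegral D γ,
      ∃ ν : D.CCA ⟶ D.CA, DoiHopf.IsV₁ D ν ∧ DoiHopf.IsNormalized₁ D ν,
      ∃ l : C ⊗[k] C →ₗ[k] C ⊗[k] A, DoiHopf.IsV₂ D l ∧ DoiHopf.IsNormalized₂ D l,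
      ∃ θ : C ⊗[k] C →ₗ[k] A, DoiHopf.IsV₃ D θ ∧ DoiHopf.IsNormalized₃ D θ,
      ∃ ψ : C ⊗[k] A →ₗ[k] C →ₗ[k] A, DoiHopf.IsV₅ D ψ ∧ DoiHopf.IsNormalized₅ D ψ] ∧
    -- a total integral makes the forgetful functor separable
    ((∃ γ : C →ₗ[k] C →ₗ[k] A, DoiHopf.IsTotalIntegral D γ) →
      DoiHopf.IsSeparable (DoiHopf.forgetCoaction D)) ∧
    -- the converse for Hopf algebras
    (DoiHopf.IsHopf k H → DoiHopf.IsSeparable (DoiHopf.forgetCoaction D) →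
      ∃ γ : C →ₗ[k] C →ₗ[k] A, DoiHopf.IsTotalIntegral D γ) ∧
    -- consequences
    (DoiHopf.IsSeparable (DoiHopf.forgetCoaction D) →
      (∀ (M N : DoiHopf.DHModule D) (f : M ⟶ N),
        (IsSplitMono ((DoiHopf.forgetCoaction D).map f) → IsSplitMono f) ∧
        (IsSplitEpi ((DoiHopf.forgetCoaction D).map f) → IsSplitEpi f)) ∧
      (∀ M : DoiHopf.DHModule D,
        (IsSemisimpleModule Aᵐᵒᵖ M.carrier → DoiHopf.IsSemisimpleObject M) ∧
        (Module.Projective Aᵐᵒᵖ M.carrier → Projective M) ∧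
        (Module.Injective Aᵐᵒᵖ M.carrier → Injective M))) := by
  refine ⟨D.totalIntegral_tfae, fun h => ?_, fun _ h => ?_, fun h => ⟨fun M N f => ?_, fun M => ?_⟩⟩
  · obtain ⟨θ, hθ, hθ'⟩ := (D.totalIntegral_tfae.out 0 3).1 h
    exact hθ.isSeparable hθ'
  · exact (D.totalIntegral_tfae.out 1 0).1 (DoiHopf.exists_V₁_of_isSeparable D h)
  · exact ⟨h.isSplitMono f, h.isSplitEpi f⟩
  · exact ⟨fun _ => h.isSemisimpleObject M, fun _ => h.projective M, fun _ => h.injective M⟩
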